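/- Let $\mathbb{H}$ be the hyperbolic plane (upper half-plane model) with boundary at infinity $\partial\mathbb{H}=\mathbb{R}\cup\{\infty\}$, where $\mathbb{H}\cup\partial\mathbb{H}$ has the topology induced from the Riemann sphere, and fix a base point $o\in\mathbb{H}$. For $g\in SL(2,\mathbb{R})$, acting on $\mathbb H$ by orientation-preserving isometries, let $D(g)=\{z\in\mathbb{H}: d(z,g o)\le d(z,o)\}$. Let $h$ be hyperbolic and $p$ parabolic such that $$\overline{D(h)\cup D(h^{-1})}\cap\overline{D(p)\cup D(p^{-1})}=\emptyset ,$$ the closures being taken in $\mathbb{H}\cup\partial\mathbb{H}$, and let $\Gamma=\langle h,p\rangle$. We use the following notions. * The limit set $\Lambda$ is the set of points of $\partial\mathbb{H}$ that lie in the closure of an orbit $\Gamma z$, $z\in\mathbb H$ (it does not depend on $z$). * A point $\xi\in\Lambda$ is radial ($\xi\in\Lambda_r$) if some sequence of points of an orbit $\Gamma z$ converges to $\xi$ and stays within bounded hyperbolic distance from a geodesic ray ending at $\xi$. * A point $\xi\in\Lambda$ belongs to $\Lambda_{br}$ (bounded radial limit points) if there are a geodesic ray $\sigma:[0,\infty)\to\mathbb{H}$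 ending at $\xi$ and a constant $c$ with $d(\sigma(t),\Gamma o)<c$ for all $t\ge 0$. The set of unbounded radial limit points is $\Lambda_{ur}=\Lambda_r\setminus\Lambda_{br}$. * A coding of $\xi$ is a sequence $(s_i)_{i\ge1}$ in $\{h,h^{-1},p,p^{-1}\}$ with $s_{i+1}\ne s_i^{-1}$ for all $i$ and $s_1s_2\cdots s_m(o)\to\xi$ as $m\to\infty$. Its exponents of $p$ are the integers $n\neq 0$ such that $p^n$ occurs in it as a (finite) maximal block of equal letters $p$ or $p^{-1}$, i.e. the integers $n_j$ when the sequence is written as $h^{m_1}p^{n_1}h^{m_2}p^{n_2}\cdots$. Then every radial limit point has exactly one coding, and a limit point $\xi\in\Lambda$ belongs to $\Lambda_{ur}$ if and only if $\xi$ is radial and the exponents of $p$ in its coding are unbounded (in absolute value). -/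

import Mathlib

open Set Filter Topology
open scoped UpperHalfPlane MatrixGroups NNReal

namespace CuspedPants

noncomputable section

/-- The hyperbolic plane `ℍ` seen inside the Riemann sphere `ℂ ∪ {∞}`. -/
def toSphere (z : ℍ) : OnePoint ℂ := ((z : ℂ) : OnePoint ℂ)

/-- The boundary at infinity `∂ℍ = ℝ ∪ {∞}` seen inside the Riemann sphere.  The compactification
`ℍ ∪ ∂ℍ` carries the topology induced by the sphere. -/
def bdry (ξ : OnePoint ℝ) : OnePoint ℂ := OnePoint.map (fun x : ℝ => (x : ℂ)) ξ

/-- The closed half-plane `D(g)`, bounded by the bisector of `[o, g o]` and containing `g o`. -/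
def halfPlane (o : ℍ) (g : SL(2, ℝ)) : Set ℍ := {z | dist z (g • o) ≤ dist z o}

/-- `h` is a hyperbolic isometry, `p` is a parabolic isometry, and the closures in `ℍ ∪ ∂ℍ` of
`D(h) ∪ D(h⁻¹)` and of `D(p) ∪ D(p⁻¹)` (with respect to the base point `o`) are disjoint. -/
structure IsSchottkyPair (o : ℍ) (h p : SL(2, ℝ)) : Prop where
  hyperbolic : (h : Matrix (Fin 2) (Fin 2) ℝ).IsHyperbolic
  parabolic : (p : Matrix (Fin 2) (Fin 2) ℝ).IsParabolic
  disjoint : Disjoint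
    (closure (toSphere '' (halfPlane o h ∪ halfPlane o h⁻¹)))
    (closure (toSphere '' (halfPlane o p ∪ halfPlane o p⁻¹)))

/-- The group `Γ = ⟨h, p⟩`. -/
def genGroup (h p : SL(2, ℝ)) : Subgroup SL(2, ℝ) := Subgroup.closure {h, p}

/-- The limit set `Λ` of `Γ`: the points of `∂ℍ` in the closure of an orbit `Γ z`
(the choice of `z` is immaterial). -/
def limitSet (Γ : Subgroup SL(2, ℝ)) : Set (OnePoint ℝ) :=
  {ξ | ∃ z : ℍ, bdry ξ ∈ closure (toSphere '' MulAction.orbit Γ z)}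

/-- `σ` is a geodesic ray, parametrized by arc length, ending at the boundary point `ξ`. -/
structure IsGeodesicRayTo (σ : ℝ≥0 → ℍ) (ξ : OnePoint ℝ) : Prop where
  isometry : Isometry σ
  endpoint : Tendsto (fun t => toSphere (σ t)) atTop (𝓝 (bdry ξ))

/-- The radial limit set `Λ_r`: a sequence in an orbit `Γ z` converges to `ξ` while staying at
bounded hyperbolic distance from a geodesic ray ending at `ξ`. -/
def radialLimitSet (Γ : Subgroup SL(2, ℝ)) : Set (OnePoint ℝ) :=
  {ξ | ξ ∈ limitSet Γ ∧ ∃ (z : ℍ) (γ : ℕ → Γ) (σ : ℝ≥0 → ℍ) (c : ℝ),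
    IsGeodesicRayTo σ ξ ∧
    Tendsto (fun n => toSphere (γ n • z)) atTop (𝓝 (bdry ξ)) ∧
    ∀ n, Metric.infDist (γ n • z) (range σ) ≤ c}

/-- The bounded radial limit set `Λ_br`: some geodesic ray ending at `ξ` stays at bounded distance
from the orbit `Γ o`. -/
def boundedRadialLimitSet (Γ : Subgroup SL(2, ℝ)) (o : ℍ) : Set (OnePoint ℝ) :=
  {ξ | ξ ∈ limitSet Γ ∧ ∃ (σ : ℝ≥0 → ℍ) (c : ℝ), IsGeodesicRayTo σ ξ ∧
    ∀ t, Metric.infDist (σ t) (MulAction.orbit Γ o) < c}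

/-- The unbounded radial limit set `Λ_ur = Λ_r \ Λ_br`. -/
def unboundedRadialLimitSet (Γ : Subgroup SL(2, ℝ)) (o : ℍ) : Set (OnePoint ℝ) :=
  radialLimitSet Γ \ boundedRadialLimitSet Γ o

/-- `s` is an infinite reduced sequence in the alphabet `{h, h⁻¹, p, p⁻¹}`. -/
def IsReducedSeq (h p : SL(2, ℝ)) (s : ℕ → SL(2, ℝ)) : Prop :=
  (∀ i, s i ∈ ({h, h⁻¹, p, p⁻¹} : Set SL(2, ℝ))) ∧ ∀ i, s (i + 1) ≠ (s i)⁻¹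

/-- `partialProd s m = s 0 * s 1 * ⋯ * s (m - 1)`. -/
def partialProd (s : ℕ → SL(2, ℝ)) : ℕ → SL(2, ℝ)
  | 0 => 1
  | m + 1 => partialProd s m * s m

/-- The infinite reduced sequence `s` is a coding of the boundary point `ξ`:
`s 0 * ⋯ * s (m - 1)` maps the base point `o` to a sequence converging to `ξ`. -/
def IsCoding (o : ℍ) (h p : SL(2, ℝ)) (s : ℕ → SL(2, ℝ)) (ξ : OnePoint ℝ) : Prop :=
  IsReducedSeq h p s ∧
    Tendsto (fun m => toSphere (partialProd s m • o)) atTop (𝓝 (bdry ξ))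

/-- From index `i` on, the sequence `s` has a maximal block of exactly `k ≥ 1` consecutive
letters `g`. -/
def IsMaximalBlock (s : ℕ → SL(2, ℝ)) (g : SL(2, ℝ)) (i k : ℕ) : Prop :=
  1 ≤ k ∧ (∀ j < k, s (i + j) = g) ∧ s (i + k) ≠ g ∧ ∀ j, j + 1 = i → s j ≠ g

/-- The exponents `n ∈ ℤ \ {0}` of the powers `p ^ n` that occur when the reduced sequence `s` is
written as an alternating product of powers of `h` and powers of `p`. -/
def exponents (p : SL(2, ℝ)) (s : ℕ → SL(2, ℝ)) : Set ℤ :=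
  {n | ∃ i k : ℕ, (IsMaximalBlock s p i k ∧ n = k) ∨ (IsMaximalBlock s p⁻¹ i k ∧ n = -k)}

/-- The exponents of `p` in `s` are unbounded in absolute value. -/
def HasUnboundedExponents (p : SL(2, ℝ)) (s : ℕ → SL(2, ℝ)) : Prop :=
  ∀ N : ℤ, ∃ n ∈ exponents p s, N < |n|

end

end CuspedPants

namespace CuspedPants

/-! Behaviour at infinity is measured by `horoNorm ξ`, up to a factor the exponential of half a
Busemann function. Its quotients are limits of quotients of cosh(d/2) along points converging to `ξ`
(`tendsto_cosh_div_cosh`), it decays like e^(-t/2) along rays to `ξ`, and it satisfies a Ptolemy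
inequality.

The half-planes of the four letters are pairwise disjoint, so the letters play ping-pong; only D(p)
and D(p⁻¹) touch at infinity. If `ξ` is a limit of points in two different half-planes seen from `γ
• o`, every orbit point is reached from `γ • o` by a word whose first letter differs from one of the
two, so `γ • o` minimizes `horoNorm ξ` on the orbit (`IsPingPong.horoNorm_le`). A radial point has
no such minimum, as `horoNorm ξ` tends to 0 along some orbit sequence. Hence a radial point has at
most one coding, and the coding never ends in a constant tail of p or p⁻¹; existence comes from
compactness of the space of words. Applied to a parabolic fixed point, the same lemma gives a
horoball with no orbit point in its interior.

At a position not interior to a p-block, the past and future of the coding lie in half-planes with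
disjoint closures, so the partial product is uniformly close to the ray
(`IsSchottkyPair.exists_dist_ray_le`). If the exponents are bounded, such positions have bounded
gaps and the orbit follows the whole ray. If not, a long p-block has both ends near the ray and on
one horosphere at a parabolic point; the ray in between dives into the empty horoball and leaves the
orbit arbitrarily far. -/

/-! ### Horospherical functions and convergence to boundary points. -/

/-- The square root of the inverse Poisson kernel of `ℍ` at the boundary point `ξ`. Its sublevel
sets are the horoballs at `ξ`. -/
noncomputable def horoNorm (ξ : OnePoint ℝ) (z : ℍ) : ℝ :=
  ξ.elim 1 (fun x => ‖(z : ℂ) - (x : ℂ)‖) / √z.im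

lemma horoNorm_infty (z : ℍ) : horoNorm OnePoint.infty z = 1 / √z.im := rfl

lemma horoNorm_coe (x : ℝ) (z : ℍ) : horoNorm (x : OnePoint ℝ) z = ‖(z : ℂ) - (x : ℂ)‖ / √z.im :=
  rfl

lemma sub_ofReal_ne_zero (x : ℝ) (z : ℍ) : (z : ℂ) - (x : ℂ) ≠ 0 := by
  intro hz
  have := congrArg Complex.im hz
  simp at this
  exact z.im_pos.ne' this

lemma horoNorm_pos (ξ : OnePoint ℝ) (z : ℍ) : 0 < horoNorm ξ z := by
  have hz := Real.sqrt_pos.2 z.im_pos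
  induction ξ using OnePoint.rec with
  | infty => rw [horoNorm_infty]; positivity
  | coe x =>
    rw [horoNorm_coe]
    exact div_pos (norm_pos_iff.2 (sub_ofReal_ne_zero x z)) hz

lemma dist_conj_ofReal (z : ℍ) (x : ℝ) :
    dist (x : ℂ) ((starRingEnd ℂ) (z : ℂ)) = dist (z : ℂ) x := by
  rw [dist_comm, ← Complex.conj_ofReal x, Complex.dist_conj_conj, Complex.conj_ofReal]

lemma dist_self_conj (z : ℍ) : dist (z : ℂ) ((starRingEnd ℂ) (z : ℂ)) = 2 * z.im := by
  rw [Complex.dist_self_conj]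
  simp [abs_of_pos z.im_pos]

/-- Busemann functions are 1-Lipschitz. For a finite `ξ = x` this is the Euclidean Ptolemy
inequality for `a`, `b`, `x` and the conjugate of `b`. -/
lemma horoNorm_le_exp_mul (ξ : OnePoint ℝ) (a b : ℍ) :
    horoNorm ξ a ≤ Real.exp (dist a b / 2) * horoNorm ξ b := by
  have ha := Real.sqrt_pos.2 a.im_pos
  have hb := Real.sqrt_pos.2 b.im_pos
  induction ξ using OnePoint.rec with
  | infty =>
    rw [horoNorm_infty, horoNorm_infty, mul_one_div, div_le_div_iff₀ ha hb, one_mul]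
    have h := UpperHalfPlane.im_le_im_mul_exp_dist b a
    rw [dist_comm b a] at h
    calc √b.im ≤ √(a.im * Real.exp (dist a b)) := Real.sqrt_le_sqrt h
      _ = Real.exp (dist a b / 2) * √a.im := by
        rw [Real.sqrt_mul a.im_pos.le, Real.exp_half, mul_comm]
  | coe x =>
    rw [horoNorm_coe, horoNorm_coe, UpperHalfPlane.exp_half_dist, Real.sqrt_mul a.im_pos.le,
      div_mul_div_comm, div_le_div_iff₀ ha (by positivity)]
    have h := EuclideanGeometry.mul_dist_le_mul_dist_add_mul_dist (a : ℂ) b x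
      ((starRingEnd ℂ) (b : ℂ))
    rw [dist_conj_ofReal, dist_self_conj] at h
    have hbb : √b.im * √b.im = b.im := Real.mul_self_sqrt b.im_pos.le
    rw [← Complex.dist_eq, ← Complex.dist_eq]
    calc dist (a : ℂ) x * (2 * (√a.im * √b.im) * √b.im)
        = dist (a : ℂ) x * (2 * b.im) * √a.im := by
          linear_combination 2 * dist (a : ℂ) x * √a.im * hbb
      _ ≤ _ := by
        refine mul_le_mul_of_nonneg_right (h.trans (le_of_eq ?_)) ha.le
        ring

/-- Ptolemy's inequality in `ℍ` with one ideal point. -/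
lemma sinh_half_dist_mul_horoNorm_le (ξ : OnePoint ℝ) (a b c : ℍ) :
    Real.sinh (dist a c / 2) * horoNorm ξ b ≤
      Real.sinh (dist a b / 2) * horoNorm ξ c + Real.sinh (dist b c / 2) * horoNorm ξ a := by
  have ha := Real.sqrt_pos.2 a.im_pos
  have hb := Real.sqrt_pos.2 b.im_pos
  have hc := Real.sqrt_pos.2 c.im_pos
  simp only [UpperHalfPlane.sinh_half_dist, Real.sqrt_mul a.im_pos.le, Real.sqrt_mul b.im_pos.le]
  have key : dist (a : ℂ) c * ξ.elim 1 (fun x => ‖(b : ℂ) - (x : ℂ)‖) ≤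
      dist (a : ℂ) b * ξ.elim 1 (fun x => ‖(c : ℂ) - (x : ℂ)‖) +
        dist (b : ℂ) c * ξ.elim 1 (fun x => ‖(a : ℂ) - (x : ℂ)‖) := by
    induction ξ using OnePoint.rec with
    | infty => simpa using dist_triangle (a : ℂ) b c
    | coe x =>
      simp only [OnePoint.elim_some, ← Complex.dist_eq]
      exact EuclideanGeometry.mul_dist_le_mul_dist_add_mul_dist (a : ℂ) b c x
  unfold horoNorm
  rw [div_mul_div_comm, div_mul_div_comm, div_mul_div_comm]
  have e1 : 2 * (√a.im * √b.im) * √c.im = 2 * (√a.im * √c.im) * √b.im := by ring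
  have e2 : 2 * (√b.im * √c.im) * √a.im = 2 * (√a.im * √c.im) * √b.im := by ring
  rw [e1, e2, ← add_div]
  gcongr

lemma tendsto_toSphere_coe {ι : Type*} {l : Filter ι} {f : ι → ℍ} {x : ℝ} :
    Tendsto (fun n => toSphere (f n)) l (𝓝 (bdry (x : OnePoint ℝ))) ↔
      Tendsto (fun n => (f n : ℂ)) l (𝓝 (x : ℂ)) := by
  exact ((OnePoint.isOpenEmbedding_coe (X := ℂ)).tendsto_nhds_iff).symm

lemma tendsto_toSphere_infty {ι : Type*} {l : Filter ι} {f : ι → ℍ} :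
    Tendsto (fun n => toSphere (f n)) l (𝓝 (bdry OnePoint.infty)) ↔
      Tendsto (fun n => ‖(f n : ℂ)‖) l atTop := by
  have : bdry OnePoint.infty = OnePoint.infty := rfl
  rw [this, tendsto_norm_atTop_iff_cobounded, ← Metric.cobounded_eq_cocompact.symm,
    ← coclosedCompact_eq_cocompact, ← OnePoint.comap_coe_nhds_infty, tendsto_comap_iff]
  rfl

lemma bdry_injective : Function.Injective bdry := by
  intro ξ η hξη
  induction ξ using OnePoint.rec <;> induction η using OnePoint.rec <;>
    simp_all [bdry]

lemma toSphere_injective : Function.Injective toSphere := fun _ _ hzw =>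
  UpperHalfPlane.ext (OnePoint.coe_injective hzw)

lemma toSphere_ne_bdry (z : ℍ) (ξ : OnePoint ℝ) : toSphere z ≠ bdry ξ := by
  induction ξ using OnePoint.rec with
  | infty => exact OnePoint.coe_ne_infty _
  | coe x =>
    intro hz
    exact sub_ofReal_ne_zero x z (sub_eq_zero.2 (OnePoint.coe_injective hz))

lemma continuous_toSphere : Continuous toSphere :=
  OnePoint.continuous_coe.comp UpperHalfPlane.continuous_coe

lemma tendsto_norm_sub_div_norm_sub {ι : Type*} {l : Filter ι} {f : ι → ℂ}
    (hf : Tendsto (fun n => ‖f n‖) l atTop) (c d : ℂ) :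
    Tendsto (fun n => ‖f n - c‖ / ‖f n - d‖) l (𝓝 1) := by
  have hd : Tendsto (fun n => ‖f n - d‖) l atTop := by
    refine tendsto_atTop_mono (fun n => norm_sub_norm_le (f n) d) ?_
    exact tendsto_atTop_add_const_right _ _ hf
  have h0 : Tendsto (fun n => ‖d - c‖ / ‖f n - d‖) l (𝓝 0) := hd.const_div_atTop _
  rw [tendsto_iff_dist_tendsto_zero]
  refine squeeze_zero' (Eventually.of_forall fun _ => dist_nonneg) ?_ h0
  filter_upwards [hd.eventually_gt_atTop 0] with n hn
  rw [Real.dist_eq, div_sub_one hn.ne', abs_div, abs_of_pos hn]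
  gcongr
  refine (abs_norm_sub_norm_le _ _).trans (le_of_eq ?_)
  congr 1
  ring

/-- The ratio of the distances from two points to a point converging to `ξ`. -/
lemma tendsto_cosh_div_cosh {ι : Type*} {l : Filter ι} {f : ι → ℍ} {ξ : OnePoint ℝ}
    (hf : Tendsto (fun n => toSphere (f n)) l (𝓝 (bdry ξ))) (a b : ℍ) :
    Tendsto (fun n => Real.cosh (dist (f n) a / 2) / Real.cosh (dist (f n) b / 2)) l
      (𝓝 (horoNorm ξ a / horoNorm ξ b)) := by
  have ha := Real.sqrt_pos.2 a.im_pos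
  have hb := Real.sqrt_pos.2 b.im_pos
  have e : ∀ n, Real.cosh (dist (f n) a / 2) / Real.cosh (dist (f n) b / 2) =
      ‖(f n : ℂ) - (starRingEnd ℂ) (a : ℂ)‖ / ‖(f n : ℂ) - (starRingEnd ℂ) (b : ℂ)‖ *
        (√b.im / √a.im) := by
    intro n
    have hn := Real.sqrt_pos.2 (f n).im_pos
    rw [UpperHalfPlane.cosh_half_dist, UpperHalfPlane.cosh_half_dist,
      Real.sqrt_mul (f n).im_pos.le, Real.sqrt_mul (f n).im_pos.le, ← Complex.dist_eq,
      ← Complex.dist_eq]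
    field_simp
  simp only [e]
  induction ξ using OnePoint.rec with
  | infty =>
    have : horoNorm OnePoint.infty a / horoNorm OnePoint.infty b = 1 * (√b.im / √a.im) := by
      rw [horoNorm_infty, horoNorm_infty]
      field_simp
    rw [this]
    exact (tendsto_norm_sub_div_norm_sub (tendsto_toSphere_infty.1 hf) _ _).mul_const _
  | coe x =>
    have h := tendsto_toSphere_coe.1 hf
    have hx : ∀ z : ℍ, ‖(x : ℂ) - (starRingEnd ℂ) (z : ℂ)‖ = ‖(z : ℂ) - (x : ℂ)‖ := fun z => by
      rw [← Complex.dist_eq, ← Complex.dist_eq, dist_conj_ofReal]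
    have hbx : ‖(b : ℂ) - (x : ℂ)‖ ≠ 0 := norm_ne_zero_iff.2 (sub_ofReal_ne_zero x b)
    have : horoNorm (x : OnePoint ℝ) a / horoNorm (x : OnePoint ℝ) b =
        ‖(x : ℂ) - (starRingEnd ℂ) (a : ℂ)‖ / ‖(x : ℂ) - (starRingEnd ℂ) (b : ℂ)‖ *
        (√b.im / √a.im) := by
      rw [horoNorm_coe, horoNorm_coe, hx, hx]
      field_simp
    rw [this]
    refine Tendsto.mul_const _ (Tendsto.div (h.sub_const _).norm (h.sub_const _).norm ?_)
    rwa [hx]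

lemma horoNorm_le_of_tendsto {ι : Type*} {l : Filter ι} [l.NeBot] {f : ι → ℍ} {ξ : OnePoint ℝ}
    (hf : Tendsto (fun n => toSphere (f n)) l (𝓝 (bdry ξ))) {a b : ℍ}
    (hab : ∀ᶠ n in l, dist (f n) a ≤ dist (f n) b) : horoNorm ξ a ≤ horoNorm ξ b := by
  have h := le_of_tendsto (tendsto_cosh_div_cosh hf a b) (b := 1) <| by
    filter_upwards [hab] with n hn
    rw [div_le_one (Real.cosh_pos _), Real.cosh_le_cosh, abs_of_nonneg (by positivity),
      abs_of_nonneg (by positivity)]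
    linarith
  rwa [div_le_one (horoNorm_pos _ _)] at h

lemma tendsto_dist_atTop {ι : Type*} {l : Filter ι} {f : ι → ℍ} {ξ : OnePoint ℝ}
    (hf : Tendsto (fun n => toSphere (f n)) l (𝓝 (bdry ξ))) (o : ℍ) :
    Tendsto (fun n => dist o (f n)) l atTop := by
  refine tendsto_atTop.2 fun R => ?_
  have hc : IsClosed (toSphere '' Metric.closedBall o R) :=
    ((isCompact_closedBall o R).image continuous_toSphere).isClosed
  have hξ : bdry ξ ∈ (toSphere '' Metric.closedBall o R)ᶜ := by
    rintro ⟨z, -, hz⟩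
    exact toSphere_ne_bdry z ξ hz
  filter_upwards [hf.eventually_mem (hc.isOpen_compl.mem_nhds hξ)] with n hn
  by_contra! hlt
  exact hn ⟨f n, by simpa [dist_comm] using hlt.le, rfl⟩

lemma half_le_cosh (x : ℝ) : x / 2 ≤ Real.cosh x := by
  rw [Real.cosh_eq]
  have := Real.add_one_le_exp x
  have := Real.exp_pos (-x)
  linarith

/-- A sequence which leaves every ball but stays in a horoball at `ξ` converges to `ξ`. -/
lemma tendsto_of_horoNorm_le {ι : Type*} {l : Filter ι} {f : ι → ℍ} {ξ : OnePoint ℝ} {o : ℍ}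
    {c : ℝ} (hc : ∀ᶠ n in l, horoNorm ξ (f n) ≤ c)
    (hd : Tendsto (fun n => dist o (f n)) l atTop) :
    Tendsto (fun n => toSphere (f n)) l (𝓝 (bdry ξ)) := by
  have ho := Real.sqrt_pos.2 o.im_pos
  have hcosh : ∀ n, dist o (f n) / 4 ≤
      ‖(f n : ℂ) - (starRingEnd ℂ) (o : ℂ)‖ / (2 * √o.im * √(f n).im) := by
    intro n
    have h := half_le_cosh (dist (f n) o / 2)
    rw [UpperHalfPlane.cosh_half_dist, Real.sqrt_mul (f n).im_pos.le, Complex.dist_eq] at h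
    rw [dist_comm]
    calc _ = dist (f n) o / 2 / 2 := by ring
      _ ≤ _ := h
      _ = _ := by congr 1; ring
  induction ξ using OnePoint.rec with
  | infty =>
    rw [tendsto_toSphere_infty]
    have hd' : Tendsto (fun n => dist o (f n) / 4) l atTop := hd.atTop_div_const (by norm_num)
    -- A horoball at infinity bounds the imaginary part below, so a large distance to `o` forces a
    -- large modulus.
    have h1 : ∀ᶠ n in l, dist o (f n) / 4 ≤ (‖(f n : ℂ)‖ + ‖(o : ℂ)‖) * (c / (2 * √o.im)) := by
      filter_upwards [hc] with n hn
      rw [horoNorm_infty] at hn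
      refine (hcosh n).trans ?_
      have hn0 := Real.sqrt_pos.2 (f n).im_pos
      calc _ = ‖(f n : ℂ) - (starRingEnd ℂ) (o : ℂ)‖ * (1 / √(f n).im / (2 * √o.im)) := by
            field_simp
        _ ≤ _ := by
            gcongr
            refine (norm_sub_le _ _).trans ?_
            rw [RCLike.norm_conj]
    have h2 := tendsto_atTop_mono' l h1 hd'
    by_cases hc0 : 0 < c / (2 * √o.im)
    · have h3 := tendsto_atTop_add_const_right l (-‖(o : ℂ)‖) (h2.atTop_div_const hc0)
      refine h3.congr fun n => ?_
      rw [mul_div_cancel_right₀ _ hc0.ne']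
      ring
    · rcases l.eq_or_neBot with rfl | hl
      · exact tendsto_bot
      exfalso
      obtain ⟨n, hn, hn'⟩ := ((hd'.eventually_gt_atTop 0).and h1).exists
      push Not at hc0
      have : (‖(f n : ℂ)‖ + ‖(o : ℂ)‖) * (c / (2 * √o.im)) ≤ 0 :=
        mul_nonpos_of_nonneg_of_nonpos (by positivity) hc0
      linarith
  | coe x =>
    rw [tendsto_toSphere_coe, tendsto_iff_norm_sub_tendsto_zero]
    set M := ‖(x : ℂ) - (starRingEnd ℂ) (o : ℂ)‖
    have hd' : Tendsto (fun n => dist o (f n) / 4 - c / (2 * √o.im)) l atTop :=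
      tendsto_atTop_add_const_right _ _ (hd.atTop_div_const (by norm_num))
    have h0 : Tendsto (fun n => c * (M / (2 * √o.im)) / (dist o (f n) / 4 - c / (2 * √o.im))) l
      (𝓝 0) := hd'.const_div_atTop _
    refine squeeze_zero' (Eventually.of_forall fun _ => norm_nonneg _) ?_ h0
    filter_upwards [hc, hd'.eventually_gt_atTop 0] with n hn hpos
    rw [horoNorm_coe] at hn
    have hn0 := Real.sqrt_pos.2 (f n).im_pos
    have hc0 : 0 ≤ c := le_trans (by positivity) hn
    -- In the horoball |f n - x| ≤ c √im, so it is enough that the imaginary part tends to 0; the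
    -- growing distance to `o` forces this.
    have h1 : dist o (f n) / 4 ≤ c / (2 * √o.im) + M / (2 * √o.im) / √(f n).im := by
      refine (hcosh n).trans ?_
      calc ‖(f n : ℂ) - (starRingEnd ℂ) (o : ℂ)‖ / (2 * √o.im * √(f n).im)
          ≤ (‖(f n : ℂ) - x‖ + M) / (2 * √o.im * √(f n).im) := by
            gcongr
            exact norm_sub_le_norm_sub_add_norm_sub _ _ _
        _ = ‖(f n : ℂ) - x‖ / √(f n).im / (2 * √o.im) + M / (2 * √o.im) / √(f n).im := by
            field_simp
        _ ≤ _ := by gcongr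
    have h2 : √(f n).im ≤ M / (2 * √o.im) / (dist o (f n) / 4 - c / (2 * √o.im)) := by
      rw [le_div_iff₀ hpos, ← le_div_iff₀' hn0]
      linarith
    calc _ ≤ c * √(f n).im := (div_le_iff₀ hn0).1 hn
      _ ≤ _ := by
        rw [mul_div_assoc]
        gcongr

/-! ### Geodesic rays. -/

lemma tendsto_cosh_sub_div_cosh (t : ℝ) :
    Tendsto (fun u : ℝ => Real.cosh ((u - t) / 2) / Real.cosh (u / 2)) atTop
      (𝓝 (Real.exp (-(t / 2)))) := by
  have h0 : Tendsto (fun u : ℝ => Real.exp (-u)) atTop (𝓝 0) :=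
    Real.tendsto_exp_atBot.comp tendsto_neg_atTop_atBot
  have h1 : Tendsto (fun u : ℝ => (Real.exp (-(t / 2)) + Real.exp (t / 2) * Real.exp (-u)) /
      (1 + Real.exp (-u))) atTop
      (𝓝 ((Real.exp (-(t / 2)) + Real.exp (t / 2) * 0) / (1 + 0))) :=
    Tendsto.div ((h0.const_mul _).const_add _) (h0.const_add _) (by norm_num)
  simp only [mul_zero, add_zero, div_one] at h1
  refine h1.congr fun u => ?_
  rw [Real.cosh_eq, Real.cosh_eq, div_div_div_cancel_right₀ two_ne_zero,
    div_eq_div_iff (by positivity) (by positivity)]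
  have e1 : Real.exp ((u - t) / 2) = Real.exp (u / 2) * Real.exp (-(t / 2)) := by
    rw [← Real.exp_add]; ring_nf
  have e2 : Real.exp (-((u - t) / 2)) = Real.exp (-(u / 2)) * Real.exp (t / 2) := by
    rw [← Real.exp_add]; ring_nf
  have e3 : Real.exp (-u) = Real.exp (-(u / 2)) * Real.exp (-(u / 2)) := by
    rw [← Real.exp_add]; ring_nf
  have e4 : Real.exp (u / 2) * Real.exp (-(u / 2)) = 1 := by
    rw [← Real.exp_add]; simp
  rw [e1, e2, e3]
  generalize Real.exp (u / 2) = x at *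
  generalize Real.exp (-(u / 2)) = y at *
  linear_combination (Real.exp (t / 2) * y - Real.exp (-(t / 2)) * y) * e4

lemma IsGeodesicRayTo.dist_eq {σ : ℝ≥0 → ℍ} {ξ : OnePoint ℝ} (hσ : IsGeodesicRayTo σ ξ)
    (t u : ℝ≥0) : dist (σ t) (σ u) = |(t : ℝ) - u| := by
  rw [hσ.isometry.dist_eq, NNReal.dist_eq]

/-- The horospherical function decays exponentially along a geodesic ray. -/
lemma IsGeodesicRayTo.horoNorm_eq {σ : ℝ≥0 → ℍ} {ξ : OnePoint ℝ} (hσ : IsGeodesicRayTo σ ξ)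
    (t : ℝ≥0) : horoNorm ξ (σ t) = Real.exp (-((t : ℝ) / 2)) * horoNorm ξ (σ 0) := by
  have h1 := tendsto_cosh_div_cosh hσ.endpoint (σ t) (σ 0)
  have h2 : Tendsto (fun u : ℝ≥0 => Real.cosh (dist (σ u) (σ t) / 2) /
      Real.cosh (dist (σ u) (σ 0) / 2)) atTop (𝓝 (Real.exp (-((t : ℝ) / 2)))) := by
    refine ((tendsto_cosh_sub_div_cosh t).comp
      (NNReal.tendsto_coe_atTop.2 tendsto_id)).congr fun u => ?_
    simp only [Function.comp_apply, hσ.dist_eq, NNReal.coe_zero, sub_zero, id]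
    rw [NNReal.abs_eq, ← Real.cosh_abs (((u : ℝ) - t) / 2), abs_div, abs_two]
  exact (div_eq_iff (horoNorm_pos _ _).ne').1 (tendsto_nhds_unique h1 h2)

/-- Points which see `ξ` in almost the opposite direction of `o` lie near every ray to `ξ`. -/
lemma IsGeodesicRayTo.exists_dist_le {σ : ℝ≥0 → ℍ} {ξ : OnePoint ℝ} (hσ : IsGeodesicRayTo σ ξ)
    (o : ℍ) {A : ℝ} (hA : 0 < A) : ∃ C : ℝ, 0 ≤ C ∧ ∀ w : ℍ,
      A * Real.cosh (dist o w / 2) * horoNorm ξ w ≤ horoNorm ξ o → ∃ t, dist w (σ t) ≤ C := by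
  have hK := horoNorm_pos ξ (σ 0)
  set B := Real.exp (dist o (σ 0) / 2) * horoNorm ξ o / (A * horoNorm ξ (σ 0)) with hB
  have hB0 : 0 < B := by have := horoNorm_pos ξ o; positivity
  refine ⟨4 * B + 1, by positivity, fun w hw => ?_⟩
  have hKw := horoNorm_pos ξ w
  set r := horoNorm ξ w / horoNorm ξ (σ 0) with hr
  have hr0 : 0 < r := by positivity
  have hcosh : Real.cosh (dist w (σ 0) / 2) ≤
      Real.exp (dist o (σ 0) / 2) * Real.cosh (dist o w / 2) := by
    have h1 : Real.cosh (dist w (σ 0) / 2) ≤ Real.cosh (dist o w / 2 + dist o (σ 0) / 2) := by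
      rw [Real.cosh_le_cosh, abs_of_nonneg (by positivity), abs_of_nonneg (by positivity)]
      have := dist_triangle w o (σ 0)
      rw [dist_comm w o] at this
      linarith
    refine h1.trans ?_
    rw [Real.cosh_add, ← Real.cosh_add_sinh]
    have := Real.sinh_lt_cosh (dist o w / 2)
    have h2 : 0 ≤ Real.sinh (dist o (σ 0) / 2) := Real.sinh_nonneg_iff.2 (by positivity)
    nlinarith
  have hcr : Real.cosh (dist w (σ 0) / 2) * r ≤ B := by
    rw [hr, hB, mul_div_assoc', div_le_div_iff₀ hK (by positivity)]
    calc _ ≤ Real.exp (dist o (σ 0) / 2) * Real.cosh (dist o w / 2) * horoNorm ξ w *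
          (A * horoNorm ξ (σ 0)) := by gcongr
      _ = Real.exp (dist o (σ 0) / 2) * (A * Real.cosh (dist o w / 2) * horoNorm ξ w) *
          horoNorm ξ (σ 0) := by ring
      _ ≤ _ := by gcongr
  -- If `r ≥ 1`, then `w` is not inside the horoball through `σ 0`, and `hcr` already bounds its
  -- distance to `σ 0`.
  rcases le_or_gt 1 r with h1 | h1
  · refine ⟨0, ?_⟩
    have h2 := half_le_cosh (dist w (σ 0) / 2)
    have h3 : Real.cosh (dist w (σ 0) / 2) ≤ Real.cosh (dist w (σ 0) / 2) * r :=
      le_mul_of_one_le_right (Real.cosh_pos _).le h1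
    linarith
  · have hlog : 0 ≤ -2 * Real.log r := by have := Real.log_neg hr0 h1; linarith
    -- This `t` puts `σ t` on the horosphere at `ξ` through `w`; Ptolemy for `w`, `σ 0`, `σ t`, `ξ`
    -- then bounds their distance.
    obtain ⟨t, ht⟩ : ∃ t : ℝ≥0, (t : ℝ) = -2 * Real.log r := CanLift.prf _ hlog
    refine ⟨t, ?_⟩
    have hexp : Real.exp ((t : ℝ) / 2) = r⁻¹ := by
      rw [ht, ← Real.exp_log (inv_pos.2 hr0), Real.log_inv]
      ring_nf
    have hexp' : Real.exp (-((t : ℝ) / 2)) = r := by rw [Real.exp_neg, hexp, inv_inv]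
    have hσt : horoNorm ξ (σ t) = r * horoNorm ξ (σ 0) := by rw [hσ.horoNorm_eq, hexp']
    have hw' : horoNorm ξ w = r * horoNorm ξ (σ 0) := by rw [hr]; field_simp
    have hpt := sinh_half_dist_mul_horoNorm_le ξ w (σ 0) (σ t)
    rw [hσt, hw'] at hpt
    have h2 : Real.sinh (dist w (σ t) / 2) ≤ (Real.sinh (dist w (σ 0) / 2) +
        Real.sinh (dist (σ 0) (σ t) / 2)) * r := by
      refine le_of_mul_le_mul_right (hpt.trans (le_of_eq ?_)) hK
      ring
    have h3 : dist (σ 0) (σ t) = t := by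
      rw [hσ.dist_eq]; simp
    have h4 : Real.sinh ((t : ℝ) / 2) * r ≤ 1 / 2 := by
      rw [Real.sinh_eq, hexp, hexp', div_mul_eq_mul_div, sub_mul, inv_mul_cancel₀ hr0.ne']
      nlinarith
    have h5 : Real.sinh (dist w (σ 0) / 2) * r ≤ B :=
      (mul_le_mul_of_nonneg_right (Real.sinh_lt_cosh _).le hr0.le).trans hcr
    have h6 : dist w (σ t) / 2 ≤ Real.sinh (dist w (σ t) / 2) :=
      Real.self_le_sinh_iff.2 (by positivity)
    rw [h3] at h2
    nlinarith

/-! ### Matrices, bisectors and half-planes. -/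

lemma coe_smul_eq (g : SL(2, ℝ)) (z : ℍ) :
    ((g • z : ℍ) : ℂ) = (g 0 0 * z + g 0 1) / (g 1 0 * z + g 1 1) := by
  simpa using UpperHalfPlane.coe_specialLinearGroup_apply g z

lemma denom_ne_zero (g : SL(2, ℝ)) (z : ℍ) : (g 1 0 * z + g 1 1 : ℂ) ≠ 0 := by
  have := UpperHalfPlane.denom_ne_zero (g : GL (Fin 2) ℝ) z
  simpa [UpperHalfPlane.denom] using this

lemma im_smul_eq (g : SL(2, ℝ)) (z : ℍ) :
    (g • z).im = z.im / ‖(g 1 0 * z + g 1 1 : ℂ)‖ ^ 2 := by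
  have := UpperHalfPlane.im_smul_eq_div_normSq (Matrix.SpecialLinearGroup.mapGL ℝ g) z
  rw [MulAction.compHom_smul_def]
  simpa [UpperHalfPlane.denom, Complex.normSq_eq_norm_sq] using this

lemma sqrt_im_smul (g : SL(2, ℝ)) (z : ℍ) :
    √(g • z).im = √z.im / ‖(g 1 0 * z + g 1 1 : ℂ)‖ := by
  rw [im_smul_eq, Real.sqrt_div z.im_pos.le, Real.sqrt_sq (norm_nonneg _)]

lemma horoNorm_infty_smul (g : SL(2, ℝ)) (z : ℍ) :
    horoNorm OnePoint.infty (g • z) = ‖(g 1 0 * z + g 1 1 : ℂ)‖ / √z.im := by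
  rw [horoNorm_infty, sqrt_im_smul, one_div_div]

lemma horoNorm_coe_smul (g : SL(2, ℝ)) (x : ℝ) (z : ℍ) :
    horoNorm (x : OnePoint ℝ) (g • z) =
      ‖(g 0 0 * z + g 0 1 : ℂ) - x * (g 1 0 * z + g 1 1)‖ / √z.im := by
  have hd := denom_ne_zero g z
  rw [horoNorm_coe, sqrt_im_smul, coe_smul_eq, div_sub' hd, norm_div, div_div_div_cancel_right₀]
  · congr 2; ring
  · exact norm_ne_zero_iff.2 hd

lemma abs_eq_one_of_sq_eq_one {x : ℝ} (hx : x ^ 2 = 1) : |x| = 1 := by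
  rwa [← pow_eq_one_iff_of_nonneg (abs_nonneg x) two_ne_zero, sq_abs]

lemma det_eq_one (g : SL(2, ℝ)) : g 0 0 * g 1 1 - g 0 1 * g 1 0 = 1 := by
  rw [← Matrix.det_fin_two]
  exact g.2

/-- A parabolic isometry preserves the horospheres at a boundary point. -/
lemma exists_horoNorm_smul_eq {g : SL(2, ℝ)} (hg : (g 0 0 + g 1 1) ^ 2 = 4) :
    ∃ ξ : OnePoint ℝ, ∀ z : ℍ, horoNorm ξ (g • z) = horoNorm ξ z := by
  have hdet := det_eq_one g
  by_cases hc : g 1 0 = 0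
  · refine ⟨OnePoint.infty, fun z => ?_⟩
    have hd : g 1 1 ^ 2 = 1 := by
      rw [hc] at hdet
      have : (g 0 0 - g 1 1) ^ 2 = 0 := by nlinarith
      have := pow_eq_zero_iff (two_ne_zero) |>.1 this
      nlinarith
    rw [horoNorm_infty_smul, horoNorm_infty, hc]
    simp only [Complex.ofReal_zero, zero_mul, zero_add, Complex.norm_real, Real.norm_eq_abs]
    rw [abs_eq_one_of_sq_eq_one hd]
  · set x : ℝ := (g 0 0 - g 1 1) / (2 * g 1 0) with hx
    refine ⟨(x : OnePoint ℝ), fun z => ?_⟩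
    have h1 : g 0 0 - x * g 1 0 = (g 0 0 + g 1 1) / 2 := by rw [hx]; field_simp; ring
    have h2 : g 0 1 - x * g 1 1 = -((g 0 0 + g 1 1) / 2) * x := by
      rw [hx]; field_simp; linear_combination hg - 4 * hdet
    have h3 : |(g 0 0 + g 1 1) / 2| = 1 := abs_eq_one_of_sq_eq_one (by linarith)
    rw [horoNorm_coe_smul, horoNorm_coe]
    have : (g 0 0 * z + g 0 1 : ℂ) - x * (g 1 0 * z + g 1 1) =
        (((g 0 0 + g 1 1) / 2 : ℝ) : ℂ) * (z - x) := by
      have h1' := congrArg (fun y : ℝ => (y : ℂ)) h1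
      have h2' := congrArg (fun y : ℝ => (y : ℂ)) h2
      push_cast at h1' h2' ⊢
      linear_combination (z : ℂ) * h1' + h2'
    rw [this, norm_mul, Complex.norm_real, Real.norm_eq_abs, h3, one_mul]

/-- The function whose modulus compares the distances from `z` to `g • o` and to `o`. -/
def bisectorFun (o : ℍ) (g : SL(2, ℝ)) (z : ℂ) : ℂ :=
  z * (g 1 0 * o + g 1 1) - (g 0 0 * o + g 0 1)

lemma mem_halfPlane_iff_norm (o : ℍ) (g : SL(2, ℝ)) (z : ℍ) :
    z ∈ halfPlane o g ↔ ‖bisectorFun o g z‖ ≤ ‖(z : ℂ) - o‖ := by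
  have hd := denom_ne_zero g o
  have hz := Real.sqrt_pos.2 z.im_pos
  have ho := Real.sqrt_pos.2 o.im_pos
  have hn : 0 < ‖(g 1 0 * o + g 1 1 : ℂ)‖ := norm_pos_iff.2 hd
  have h1 : dist z (g • o) ≤ dist z o ↔
      Real.sinh (dist z (g • o) / 2) ≤ Real.sinh (dist z o / 2) := by
    rw [Real.sinh_le_sinh, div_le_div_iff_of_pos_right two_pos]
  have h2 : bisectorFun o g z = ((z : ℂ) - (g • o : ℍ)) * (g 1 0 * o + g 1 1) := by
    rw [coe_smul_eq, sub_mul, div_mul_cancel₀ _ hd, bisectorFun]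
  change dist z (g • o) ≤ dist z o ↔ _
  rw [h1, UpperHalfPlane.sinh_half_dist, UpperHalfPlane.sinh_half_dist, Real.sqrt_mul z.im_pos.le,
    Real.sqrt_mul z.im_pos.le, sqrt_im_smul, h2, norm_mul, Complex.dist_eq, Complex.dist_eq,
    ← mul_le_mul_iff_of_pos_right (show 0 < 2 * (√z.im * √o.im) by positivity),
    div_mul_cancel₀ _ (by positivity)]
  congr! 1
  field_simp

/-- Cayley–Hamilton, g + g⁻¹ = tr(g)·1, since `bisectorFun` is linear in the entries of `g`. A point
common to D(g) and D(g⁻¹) therefore satisfies |tr g| |z - o| ≤ 2 |z - o|. -/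
lemma bisectorFun_add_inv (o : ℍ) (g : SL(2, ℝ)) (z : ℂ) :
    bisectorFun o g z + bisectorFun o g⁻¹ z = ((g 0 0 + g 1 1 : ℝ) : ℂ) * (z - o) := by
  simp only [bisectorFun, Matrix.SpecialLinearGroup.SL2_inv_expl, Matrix.cons_val',
    Matrix.cons_val_zero, Matrix.cons_val_one, Matrix.cons_val_fin_one]
  push_cast
  ring

lemma exists_filter_of_mem_closure {A : Set ℍ} {q : OnePoint ℂ}
    (hq : q ∈ closure (toSphere '' A)) :
    ∃ l : Filter ℍ, l.NeBot ∧ Tendsto toSphere l (𝓝 q) ∧ ∀ᶠ z in l, z ∈ A := by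
  have hne := mem_closure_iff_nhdsWithin_neBot.1 hq
  refine ⟨comap toSphere (𝓝[toSphere '' A] q) ⊓ 𝓟 A,
    comap_inf_principal_neBot_of_image_mem hne self_mem_nhdsWithin, ?_, ?_⟩
  · exact (tendsto_comap.mono_left inf_le_left).mono_right nhdsWithin_le_nhds
  · exact mem_inf_of_right (mem_principal_self A)

lemma tendsto_coe_of_tendsto_toSphere {l : Filter ℍ} {z : ℂ}
    (h : Tendsto toSphere l (𝓝 (z : OnePoint ℂ))) :
    Tendsto (fun w : ℍ => (w : ℂ)) l (𝓝 z) :=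
  ((OnePoint.isOpenEmbedding_coe (X := ℂ)).tendsto_nhds_iff).2 h

lemma im_nonneg_of_mem_closure {A : Set ℍ} {z : ℂ}
    (hz : (z : OnePoint ℂ) ∈ closure (toSphere '' A)) : 0 ≤ z.im := by
  obtain ⟨l, hl, h, -⟩ := exists_filter_of_mem_closure hz
  exact ge_of_tendsto ((Complex.continuous_im.tendsto z).comp (tendsto_coe_of_tendsto_toSphere h))
    (Eventually.of_forall fun w => w.im_pos.le)

lemma norm_bisectorFun_le_of_mem_closure {o : ℍ} {g : SL(2, ℝ)} {z : ℂ}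
    (hz : (z : OnePoint ℂ) ∈ closure (toSphere '' halfPlane o g)) :
    ‖bisectorFun o g z‖ ≤ ‖z - o‖ := by
  obtain ⟨l, hl, h, hA⟩ := exists_filter_of_mem_closure hz
  have h' := tendsto_coe_of_tendsto_toSphere h
  refine le_of_tendsto_of_tendsto ((h'.mul_const _).sub_const _).norm (h'.sub_const _).norm ?_
  filter_upwards [hA] with w hw
  exact (mem_halfPlane_iff_norm o g w).1 hw

lemma norm_denom_le_of_infty_mem_closure {o : ℍ} {g : SL(2, ℝ)}
    (hz : OnePoint.infty ∈ closure (toSphere '' halfPlane o g)) :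
    ‖(g 1 0 * o + g 1 1 : ℂ)‖ ≤ 1 := by
  obtain ⟨l, hl, h, hA⟩ := exists_filter_of_mem_closure hz
  have hd := denom_ne_zero g o
  have h1 := (tendsto_norm_sub_div_norm_sub (tendsto_toSphere_infty.1 h)
    ((g 0 0 * o + g 0 1) / (g 1 0 * o + g 1 1)) o).const_mul ‖(g 1 0 * o + g 1 1 : ℂ)‖
  rw [mul_one] at h1
  refine le_of_tendsto h1 ?_
  filter_upwards [hA] with w hw
  rw [← mul_div_assoc, ← norm_mul, mul_sub, mul_div_cancel₀ _ hd, mul_comm]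
  exact div_le_one_of_le₀ ((mem_halfPlane_iff_norm o g w).1 hw) (norm_nonneg _)

/-- Vanishing at `o` means that `g` fixes `o`, hence is elliptic or ±1. This settles the case `z =
o`, where the trace inequality says nothing. -/
lemma four_le_sq_of_bisectorFun_self {o : ℍ} {g : SL(2, ℝ)} (h : bisectorFun o g o = 0) :
    (g 0 0 + g 1 1) ^ 2 ≤ 4 := by
  have hdet := det_eq_one g
  have him := congrArg Complex.im h
  have hre := congrArg Complex.re h
  simp [bisectorFun] at him hre
  have ho := o.im_pos
  set x := o.re
  set y := o.im
  have h1 : g 1 1 - g 0 0 = -2 * g 1 0 * x := by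
    have : y * (g 1 1 - g 0 0 + 2 * g 1 0 * x) = 0 := by linear_combination him
    rcases mul_eq_zero.1 this with h | h <;> linarith
  have h2 : g 0 1 = -g 1 0 * (x ^ 2 + y ^ 2) := by linear_combination -hre + x * h1
  have h3 : (g 0 0 + g 1 1) ^ 2 - 4 = -4 * (g 1 0 * y) ^ 2 := by
    linear_combination 4 * hdet + (g 1 1 - g 0 0 - 2 * g 1 0 * x) * h1 + 4 * g 1 0 * h2
  nlinarith [sq_nonneg (g 1 0 * y)]

lemma disjoint_closure_halfPlane_inv (o : ℍ) {g : SL(2, ℝ)} (hg : 4 < (g 0 0 + g 1 1) ^ 2) :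
    Disjoint (closure (toSphere '' halfPlane o g)) (closure (toSphere '' halfPlane o g⁻¹)) := by
  have hab : 2 < |g 0 0 + g 1 1| := by
    rw [← sq_abs] at hg
    nlinarith [abs_nonneg (g 0 0 + g 1 1)]
  rw [Set.disjoint_left]
  intro q hq hq'
  induction q using OnePoint.rec with
  | infty =>
    have h1 := norm_denom_le_of_infty_mem_closure hq
    have h2 := norm_denom_le_of_infty_mem_closure hq'
    have h3 := norm_add_le (g 1 0 * o + g 1 1 : ℂ) (g⁻¹ 1 0 * o + g⁻¹ 1 1 : ℂ)
    have h4 : (g 1 0 * o + g 1 1 : ℂ) + (g⁻¹ 1 0 * o + g⁻¹ 1 1 : ℂ) =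
        ((g 0 0 + g 1 1 : ℝ) : ℂ) := by
      simp [Matrix.SpecialLinearGroup.SL2_inv_expl]
      ring
    rw [h4, Complex.norm_real, Real.norm_eq_abs] at h3
    linarith
  | coe z =>
    have h1 := norm_bisectorFun_le_of_mem_closure hq
    have h2 := norm_bisectorFun_le_of_mem_closure hq'
    have h3 := norm_add_le (bisectorFun o g z) (bisectorFun o g⁻¹ z)
    rw [bisectorFun_add_inv, norm_mul, Complex.norm_real, Real.norm_eq_abs] at h3
    rcases (norm_nonneg (z - o)).eq_or_lt with h0 | h0
    · rw [← h0] at h1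
      obtain rfl : z = o := sub_eq_zero.1 (norm_eq_zero.1 h0.symm)
      have := four_le_sq_of_bisectorFun_self (norm_le_zero_iff.1 h1)
      linarith
    · nlinarith

lemma disjoint_halfPlane_inv_of_parabolic (o : ℍ) {g : SL(2, ℝ)}
    (hg : (g : Matrix (Fin 2) (Fin 2) ℝ).IsParabolic) :
    Disjoint (halfPlane o g) (halfPlane o g⁻¹) := by
  have hdet := det_eq_one g
  have htr : (g 0 0 + g 1 1) ^ 2 = 4 := by
    have := hg.2
    rw [Matrix.discr_fin_two, g.2, Matrix.trace_fin_two] at this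
    linarith
  rw [Set.disjoint_left]
  intro z hz hz'
  rw [mem_halfPlane_iff_norm] at hz hz'
  have hadd := bisectorFun_add_inv o g z
  set f₁ := bisectorFun o g z with hf₁
  set f₂ := bisectorFun o g⁻¹ z
  set w : ℂ := z - o with hw
  -- With |tr g| = 2 the triangle inequality is an equality, and the parallelogram law forces the
  -- two summands to agree.
  have heq : f₁ = f₂ := by
    have hpar := parallelogram_law_with_norm ℝ f₁ f₂
    rw [hadd, norm_mul, Complex.norm_real, Real.norm_eq_abs] at hpar
    have habs : |g 0 0 + g 1 1| * |g 0 0 + g 1 1| = 4 := by rw [abs_mul_abs_self]; linarith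
    have h1 : ‖f₁‖ * ‖f₁‖ ≤ ‖w‖ * ‖w‖ := mul_self_le_mul_self (norm_nonneg _) hz
    have h2 : ‖f₂‖ * ‖f₂‖ ≤ ‖w‖ * ‖w‖ := mul_self_le_mul_self (norm_nonneg _) hz'
    have h3 : ‖f₁ - f₂‖ * ‖f₁ - f₂‖ ≤ 0 := by
      have : |g 0 0 + g 1 1| * ‖w‖ * (|g 0 0 + g 1 1| * ‖w‖) = 4 * (‖w‖ * ‖w‖) := by
        rw [← habs]; ring
      linarith
    have h4 : ‖f₁ - f₂‖ = 0 := mul_self_eq_zero.1 (le_antisymm h3 (mul_self_nonneg _))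
    exact sub_eq_zero.1 (norm_eq_zero.1 h4)
  rw [← heq, hf₁, hw, bisectorFun] at hadd
  set e : ℝ := (g 0 0 - g 1 1) / 2 with he
  have hbc : g 0 1 * g 1 0 = -e ^ 2 := by rw [he]; linear_combination htr / 4 - hdet
  -- Both `z` and `o` are non-real, so a vanishing factor gives c = 0; then `g` is scalar, which
  -- parabolicity excludes.
  have hprod : ((z : ℂ) * g 1 0 - e) * (g 1 0 * o - e) = 0 := by
    have hbc' := congrArg (fun y : ℝ => (y : ℂ)) hbc
    have he' := congrArg (fun y : ℝ => (y : ℂ)) he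
    push_cast at hbc' he' hadd
    rw [he'] at hbc' ⊢
    linear_combination (g 1 0 : ℂ) / 2 * hadd + hbc'
  have hc : g 1 0 = 0 := by
    rcases mul_eq_zero.1 hprod with h | h <;>
    · have him := congrArg Complex.im h
      simpa [z.im_pos.ne', o.im_pos.ne'] using him
  have he0 : e = 0 := by
    rw [hc, mul_zero] at hbc
    exact pow_eq_zero_iff two_ne_zero |>.1 (by linarith)
  have hda : g 1 1 = g 0 0 := by rw [he] at he0; linarith
  have hb : g 0 1 = 0 := by
    rw [hc, hda] at hadd
    push_cast at hadd
    have : (g 0 1 : ℂ) = 0 := by linear_combination -hadd / 2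
    exact_mod_cast this
  refine hg.1 ⟨g 0 0, ?_⟩
  ext i j
  fin_cases i <;> fin_cases j <;> simp [hc, hb, hda]

/-- Subsets of `ℍ` with disjoint closures in `ℍ ∪ ∂ℍ` are seen from `o` at definite angle. -/
lemma exists_mul_cosh_le_sinh (o : ℍ) {A B : Set ℍ}
    (hAB : Disjoint (closure (toSphere '' A)) (closure (toSphere '' B))) :
    ∃ δ : ℝ, 0 < δ ∧ ∀ u ∈ A, ∀ v ∈ B,
      δ * Real.cosh (dist u o / 2) * Real.cosh (dist v o / 2) ≤ Real.sinh (dist u v / 2) := by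
  set o' : ℂ := (starRingEnd ℂ) (o : ℂ) with ho'
  have him : o'.im < 0 := by simp [ho', o.im_pos]
  -- Inversion at the conjugate of `o` makes the closures compact subsets of ℂ, and 2 im(o) |f u - f
  -- v| equals sinh(d(u,v)/2) / (cosh(d(u,o)/2) cosh(d(v,o)/2)). Euclidean separation of the images
  -- thus gives `δ`.
  set f : OnePoint ℂ → ℂ := fun q => q.elim 0 (fun z => (z - o')⁻¹) with hf
  have hcont : ∀ q : OnePoint ℂ, q ≠ (o' : OnePoint ℂ) → ContinuousAt f q := by
    intro q hq
    induction q using OnePoint.rec with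
    | infty =>
      rw [OnePoint.continuousAt_infty', coclosedCompact_eq_cocompact,
        ← Metric.cobounded_eq_cocompact]
      exact tendsto_inv₀_cobounded.comp (tendsto_sub_const_cobounded o')
    | coe z =>
      rw [OnePoint.continuousAt_coe]
      have : z - o' ≠ 0 := fun h => hq (congrArg _ (sub_eq_zero.1 h))
      exact ContinuousAt.inv₀ (by fun_prop) this
  have hinj : ∀ q r : OnePoint ℂ, q ≠ (o' : OnePoint ℂ) → r ≠ (o' : OnePoint ℂ) → f q = f r →
      q = r := by
    intro q r hq hr hqr
    induction q using OnePoint.rec with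
    | infty =>
      induction r using OnePoint.rec with
      | infty => rfl
      | coe z =>
        have : z - o' = 0 := by simpa [hf] using hqr.symm
        exact absurd (congrArg _ (sub_eq_zero.1 this)) hr
    | coe y =>
      induction r using OnePoint.rec with
      | infty =>
        have : y - o' = 0 := by simpa [hf] using hqr
        exact absurd (congrArg _ (sub_eq_zero.1 this)) hq
      | coe z =>
        have : y = z := by simpa [hf] using hqr
        rw [this]
  have hne : ∀ (C : Set ℍ), ∀ q ∈ closure (toSphere '' C), q ≠ (o' : OnePoint ℂ) := by
    rintro C q hq rfl
    exact absurd (im_nonneg_of_mem_closure hq) (not_le.2 him)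
  have hcpt : ∀ C : Set ℍ, IsCompact (f '' closure (toSphere '' C)) := fun C =>
    isClosed_closure.isCompact.image_of_continuousOn fun q hq =>
      (hcont q (hne C q hq)).continuousWithinAt
  have hdisj : Disjoint (f '' closure (toSphere '' A)) (f '' closure (toSphere '' B)) := by
    rw [Set.disjoint_left]
    rintro _ ⟨q, hq, rfl⟩ ⟨r, hr, hqr⟩
    have := hinj r q (hne B r hr) (hne A q hq) hqr
    exact Set.disjoint_left.1 hAB hq (this ▸ hr)
  obtain ⟨r, hr, hsep⟩ := Metric.exists_pos_forall_lt_edist (hcpt A) (hcpt B).isClosed hdisj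
  refine ⟨2 * o.im * r, by have := o.im_pos; positivity, fun u hu v hv => ?_⟩
  have h1 := hsep _ ⟨_, subset_closure ⟨u, hu, rfl⟩, rfl⟩ _ ⟨_, subset_closure ⟨v, hv, rfl⟩, rfl⟩
  rw [edist_nndist, ENNReal.coe_lt_coe] at h1
  have h2 : (r : ℝ) ≤ ‖((u : ℂ) - o')⁻¹ - ((v : ℂ) - o')⁻¹‖ := by
    rw [← Complex.dist_eq, ← coe_nndist]
    exact_mod_cast h1.le
  have hu' : (u : ℂ) - o' ≠ 0 := by
    intro h
    have := congrArg Complex.im h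
    simp at this
    linarith [u.im_pos]
  have hv' : (v : ℂ) - o' ≠ 0 := by
    intro h
    have := congrArg Complex.im h
    simp at this
    linarith [v.im_pos]
  rw [inv_sub_inv hu' hv', norm_div, norm_mul, norm_sub_rev, le_div_iff₀ (by positivity)] at h2
  have hsu := Real.sqrt_pos.2 u.im_pos
  have hsv := Real.sqrt_pos.2 v.im_pos
  have hso := Real.sqrt_pos.2 o.im_pos
  rw [UpperHalfPlane.cosh_half_dist, UpperHalfPlane.cosh_half_dist, UpperHalfPlane.sinh_half_dist,
    Real.sqrt_mul u.im_pos.le, Real.sqrt_mul u.im_pos.le, Real.sqrt_mul v.im_pos.le,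
    Complex.dist_eq, Complex.dist_eq, Complex.dist_eq, ← ho']
  have hoo : o.im = √o.im * √o.im := (Real.mul_self_sqrt o.im_pos.le).symm
  calc _ = r * (‖(u : ℂ) - o'‖ * ‖(v : ℂ) - o'‖) / (2 * (√u.im * √v.im)) := by
        rw [hoo]
        have : √(√o.im * √o.im) = √o.im := by rw [← hoo]
        rw [this]
        field_simp
    _ ≤ _ := by
        rw [sub_sub_sub_cancel_right] at h2
        gcongr

/-! ### Ping-pong and reduced words. -/

section

/-- A finite symmetric set of isometries whose half-planes with respect to `o` are disjoint. -/
structure IsPingPong (o : ℍ) (S : Set SL(2, ℝ)) : Prop where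
  finite : S.Finite
  inv_mem : ∀ a ∈ S, a⁻¹ ∈ S
  ne_inv : ∀ a ∈ S, a ≠ a⁻¹
  disjoint : ∀ a ∈ S, ∀ b ∈ S, a ≠ b → Disjoint (halfPlane o a) (halfPlane o b)

/-- A finite reduced word in the alphabet `S`. -/
def IsReducedWord (S : Set SL(2, ℝ)) (l : List SL(2, ℝ)) : Prop :=
  (∀ a ∈ l, a ∈ S) ∧ l.IsChain (fun a b => b ≠ a⁻¹)

variable {o : ℍ} {S : Set SL(2, ℝ)}

lemma smul_base_mem_halfPlane (o : ℍ) (a : SL(2, ℝ)) : a • o ∈ halfPlane o a := by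
  simp [halfPlane]

lemma dist_inv_smul_left (a : SL(2, ℝ)) (z w : ℍ) : dist (a⁻¹ • z) w = dist z (a • w) := by
  rw [← dist_smul a (a⁻¹ • z) w, smul_inv_smul]

/-- `a⁻¹` carries the bisector of [o, a o] to that of [a⁻¹ o, o]: the basic ping-pong move. -/
lemma inv_smul_mem_halfPlane {a : SL(2, ℝ)} {z : ℍ} (hz : z ∉ halfPlane o a) :
    a⁻¹ • z ∈ halfPlane o a⁻¹ := by
  simp only [halfPlane, mem_ofPred_eq, not_le] at hz ⊢
  rw [dist_smul, dist_inv_smul_left]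
  exact hz.le

lemma IsPingPong.notMem (H : IsPingPong o S) {a b : SL(2, ℝ)} (ha : a ∈ S) (hb : b ∈ S)
    (hab : a ≠ b) {z : ℍ} (hz : z ∈ halfPlane o a) : z ∉ halfPlane o b :=
  Set.disjoint_left.1 (H.disjoint a ha b hb hab) hz

lemma IsPingPong.base_notMem (H : IsPingPong o S) {a : SL(2, ℝ)} (ha : a ∈ S) :
    o ∉ halfPlane o a := by
  intro ho
  refine H.notMem ha (H.inv_mem a ha) (H.ne_inv a ha) ho ?_
  simp only [halfPlane, mem_ofPred_eq, dist_self] at ho ⊢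
  rwa [dist_comm, dist_inv_smul_left]

lemma IsReducedWord.tail {a : SL(2, ℝ)} {l : List SL(2, ℝ)} (hl : IsReducedWord S (a :: l)) :
    IsReducedWord S l :=
  ⟨fun b hb => hl.1 b (List.mem_cons_of_mem _ hb), hl.2.tail⟩

lemma IsReducedWord.drop {l : List SL(2, ℝ)} (hl : IsReducedWord S l) (n : ℕ) :
    IsReducedWord S (l.drop n) :=
  ⟨fun b hb => hl.1 b (List.mem_of_mem_drop hb), hl.2.drop n⟩

lemma IsReducedWord.head_ne {a : SL(2, ℝ)} {l : List SL(2, ℝ)}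
    (hl : IsReducedWord S (a :: l)) : ∀ b ∈ l.head?, b ≠ a⁻¹ := by
  cases l with
  | nil => simp
  | cons c l => simpa using (List.isChain_cons_cons.1 hl.2).1

/-- The induction step of the two distance comparisons below: it passes their hypothesis from a word
to its tail. -/
lemma IsPingPong.inv_smul_notMem (H : IsPingPong o S) {a : SL(2, ℝ)} {l : List SL(2, ℝ)}
    (hl : IsReducedWord S (a :: l)) {z : ℍ} (hz : z ∉ halfPlane o a) :
    ∀ b ∈ l.head?, a⁻¹ • z ∉ halfPlane o b := fun b hb =>
  H.notMem (H.inv_mem a (hl.1 a (by simp))) (hl.tail.1 b (List.mem_of_mem_head? hb))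
    (hl.head_ne b hb).symm (inv_smul_mem_halfPlane hz)

lemma IsPingPong.dist_lt_append (H : IsPingPong o S) {b : SL(2, ℝ)} {l : List SL(2, ℝ)} {z : ℍ}
    (hl : IsReducedWord S (l ++ [b])) (hz : ∀ a ∈ (l ++ [b]).head?, z ∉ halfPlane o a) :
    dist z (l.prod • o) < dist z ((l ++ [b]).prod • o) := by
  induction l generalizing z with
  | nil =>
    have := hz b (by simp)
    simpa [halfPlane] using this
  | cons a l ih =>
    have := ih hl.tail (H.inv_smul_notMem hl (hz a (by simp)))
    rwa [dist_inv_smul_left, dist_inv_smul_left, ← mul_smul, ← mul_smul, ← List.prod_cons,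
      ← List.prod_cons] at this

lemma IsPingPong.dist_le_dist_prod (H : IsPingPong o S) {l : List SL(2, ℝ)} {z : ℍ}
    (hl : IsReducedWord S l) (hz : ∀ a ∈ l.head?, z ∉ halfPlane o a) :
    dist z o ≤ dist z (l.prod • o) := by
  induction l generalizing z with
  | nil => simp
  | cons a l ih =>
    have hza := hz a (by simp)
    have := ih hl.tail (H.inv_smul_notMem hl hza)
    rw [dist_inv_smul_left, dist_inv_smul_left, ← mul_smul, ← List.prod_cons] at this
    simp only [halfPlane, mem_ofPred_eq, not_le] at hza
    exact hza.le.trans this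

lemma IsPingPong.prod_smul_mem (H : IsPingPong o S) {a : SL(2, ℝ)} {l : List SL(2, ℝ)}
    (hl : IsReducedWord S (a :: l)) : (a :: l).prod • o ∈ halfPlane o a := by
  have key : l.prod • o ∉ halfPlane o a⁻¹ := by
    induction l generalizing a with
    | nil => simpa using H.base_notMem (H.inv_mem a (hl.1 a (by simp)))
    | cons b l ih =>
      have hb := ih hl.tail
      refine H.notMem (hl.1 b (by simp)) (H.inv_mem a (hl.1 a (by simp)))
        (hl.head_ne b (by simp)) ?_
      have := inv_smul_mem_halfPlane hb
      rwa [inv_inv, ← mul_smul, ← List.prod_cons] at this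
  have := inv_smul_mem_halfPlane key
  rwa [inv_inv, ← mul_smul, ← List.prod_cons] at this

lemma exists_reducedWord_mul {a : SL(2, ℝ)} (ha : a ∈ S)
    {l : List SL(2, ℝ)} (hl : IsReducedWord S l) :
    ∃ l', IsReducedWord S l' ∧ l'.prod = a * l.prod := by
  by_cases hc : ∀ b ∈ l.head?, b ≠ a⁻¹
  · refine ⟨a :: l, ⟨?_, ?_⟩, List.prod_cons⟩
    · simpa using ⟨ha, hl.1⟩
    · cases l with
      | nil => exact List.isChain_singleton _
      | cons b l => exact List.isChain_cons_cons.2 ⟨hc b (by simp), hl.2⟩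
  · push Not at hc
    obtain ⟨b, hb, rfl⟩ := hc
    cases l with
    | nil => simp at hb
    | cons c l =>
      obtain rfl : c = a⁻¹ := by simpa using hb
      exact ⟨l, hl.tail, by simp⟩

lemma exists_reducedWord {h p γ : SL(2, ℝ)} (hγ : γ ∈ genGroup h p) :
    ∃ l, IsReducedWord {h, h⁻¹, p, p⁻¹} l ∧ l.prod = γ := by
  induction hγ using Subgroup.closure_induction_left with
  | one => exact ⟨[], ⟨by simp, List.isChain_nil⟩, rfl⟩
  | mul_left x hx y _ ih =>
    obtain ⟨l, hl, rfl⟩ := ih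
    refine exists_reducedWord_mul ?_ hl
    rcases hx with rfl | rfl <;> simp
  | inv_mul_cancel x hx y _ ih =>
    obtain ⟨l, hl, rfl⟩ := ih
    refine exists_reducedWord_mul ?_ hl
    rcases hx with rfl | rfl <;> simp

/-- An infinite reduced sequence in the alphabet `S`. -/
def IsReducedSeqIn (S : Set SL(2, ℝ)) (s : ℕ → SL(2, ℝ)) : Prop :=
  (∀ i, s i ∈ S) ∧ ∀ i, s (i + 1) ≠ (s i)⁻¹

variable {s : ℕ → SL(2, ℝ)}

lemma IsReducedSeqIn.shift (hs : IsReducedSeqIn S s) (k : ℕ) :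
    IsReducedSeqIn S (fun i => s (k + i)) :=
  ⟨fun _ => hs.1 _, fun _ => hs.2 _⟩

lemma partialProd_eq_prod (s : ℕ → SL(2, ℝ)) (n : ℕ) :
    partialProd s n = ((List.range n).map s).prod := by
  induction n with
  | zero => rfl
  | succ n ih => rw [partialProd, ih, List.range_succ]; simp

lemma partialProd_add (s : ℕ → SL(2, ℝ)) (k n : ℕ) :
    partialProd s (k + n) = partialProd s k * partialProd (fun i => s (k + i)) n := by
  induction n with
  | zero => simp [partialProd]
  | succ n ih => rw [← add_assoc, partialProd, ih, partialProd, mul_assoc]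

lemma partialProd_congr {s t : ℕ → SL(2, ℝ)} {n : ℕ} (hst : ∀ i < n, s i = t i) :
    partialProd s n = partialProd t n := by
  induction n with
  | zero => rfl
  | succ n ih => rw [partialProd, partialProd, ih fun i hi => hst i (by omega), hst n (by omega)]

lemma partialProd_const (g : SL(2, ℝ)) (n : ℕ) : partialProd (fun _ => g) n = g ^ n := by
  induction n with
  | zero => rfl
  | succ n ih => rw [partialProd, ih, pow_succ]

lemma IsReducedSeqIn.isReducedWord (hs : IsReducedSeqIn S s) (n : ℕ) :
    IsReducedWord S ((List.range n).map s) := by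
  refine ⟨?_, ?_⟩
  · simp only [List.mem_map]
    rintro _ ⟨i, -, rfl⟩
    exact hs.1 i
  · rw [List.isChain_map, List.isChain_iff_getElem]
    intro i hi
    simpa using hs.2 i

lemma partialProd_mem {Γ : Subgroup SL(2, ℝ)} (hs : IsReducedSeqIn S s) (hS : S ⊆ Γ) (n : ℕ) :
    partialProd s n ∈ Γ := by
  induction n with
  | zero => exact Γ.one_mem
  | succ n ih => exact Γ.mul_mem ih (hS (hs.1 n))

lemma IsPingPong.partialProd_smul_mem (H : IsPingPong o S) (hs : IsReducedSeqIn S s) (n : ℕ) :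
    partialProd s (n + 1) • o ∈ halfPlane o (s 0) := by
  have hl := hs.isReducedWord (n + 1)
  rw [partialProd_eq_prod]
  rw [List.range_succ_eq_map, List.map_cons] at hl ⊢
  exact H.prod_smul_mem hl

lemma IsPingPong.inv_partialProd_smul_mem (H : IsPingPong o S) (hs : IsReducedSeqIn S s)
    {k n : ℕ} (hkn : k < n) :
    (partialProd s k)⁻¹ • partialProd s n • o ∈ halfPlane o (s k) := by
  obtain ⟨m, rfl⟩ := Nat.exists_eq_add_of_lt hkn
  rw [add_assoc, partialProd_add, mul_smul, inv_smul_smul]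
  exact H.partialProd_smul_mem (hs.shift k) m

lemma IsPingPong.dist_partialProd_lt (H : IsPingPong o S) (hs : IsReducedSeqIn S s) (n : ℕ) :
    dist o (partialProd s n • o) < dist o (partialProd s (n + 1) • o) := by
  have hl := hs.isReducedWord (n + 1)
  rw [partialProd_eq_prod, partialProd_eq_prod]
  rw [List.range_succ, List.map_append, List.map_singleton] at hl ⊢
  exact H.dist_lt_append hl fun a ha => H.base_notMem (hl.1 a (List.mem_of_mem_head? ha))

lemma IsPingPong.inv_partialProd_base_mem (H : IsPingPong o S) (hs : IsReducedSeqIn S s) (n : ℕ) :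
    (partialProd s (n + 1))⁻¹ • o ∈ halfPlane o (s n)⁻¹ := by
  have h := H.dist_partialProd_lt hs n
  simp only [halfPlane, mem_ofPred_eq]
  rw [dist_inv_smul_left, dist_inv_smul_left, ← mul_smul, partialProd, mul_inv_cancel_right]
  exact h.le

lemma IsPingPong.exists_pos_le_dist (H : IsPingPong o S) :
    ∃ ε > 0, ∀ a ∈ S, ∀ z ∈ halfPlane o a, ε ≤ dist o z := by
  rcases S.eq_empty_or_nonempty with rfl | hne
  · exact ⟨1, one_pos, by simp⟩
  obtain ⟨a, ha, hmin⟩ := Set.exists_min_image S (fun a => dist o (a • o)) H.finite hne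
  refine ⟨dist o (a • o) / 2, ?_, fun b hb z hz => ?_⟩
  · have := H.base_notMem ha
    simp only [halfPlane, mem_ofPred_eq, dist_self, not_le] at this
    linarith
  · have h1 := hmin b hb
    have h2 := dist_triangle o z (b • o)
    simp only [halfPlane, mem_ofPred_eq] at hz
    rw [dist_comm z o] at hz
    linarith

/-- The distances increase. If they were bounded, two points of the sequence would be closer than
`ε`; but translating the earlier one to `o` puts the later one in a half-plane, at distance at least
`ε`. -/
lemma IsPingPong.tendsto_dist_partialProd (H : IsPingPong o S) (hs : IsReducedSeqIn S s) :
    Tendsto (fun n => dist o (partialProd s n • o)) atTop atTop := by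
  rcases tendsto_atTop_of_monotone (monotone_nat_of_le_succ fun n => (H.dist_partialProd_lt hs n).le)
    with h | ⟨R, hR⟩
  · exact h
  exfalso
  obtain ⟨B, hB⟩ := hR.bddAbove_range
  obtain ⟨ε, hε, hsep⟩ := H.exists_pos_le_dist
  obtain ⟨x, -, φ, hφ, hx⟩ := (isCompact_closedBall o B).tendsto_subseq
    (x := fun n => partialProd s n • o) fun n => by
      rw [Metric.mem_closedBall, dist_comm]; exact hB ⟨n, rfl⟩
  obtain ⟨N, hN⟩ := Metric.cauchySeq_iff.1 hx.cauchySeq ε hε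
  have h1 := hN N le_rfl (N + 1) (Nat.le_succ N)
  have h2 := hsep _ (hs.1 _) _ (H.inv_partialProd_smul_mem hs (hφ (Nat.lt_succ_self N)))
  rw [dist_comm, dist_inv_smul_left, dist_comm] at h2
  exact absurd h1 (not_lt.2 h2)

/-- A boundary point in the closure of two distinct half-planes at `γ • o` lies outside all
horoballs through the other points of the orbit. -/
lemma IsPingPong.horoNorm_le {h p : SL(2, ℝ)} (H : IsPingPong o {h, h⁻¹, p, p⁻¹})
    {ξ : OnePoint ℝ} {a b : SL(2, ℝ)}
    (hab : a ≠ b) (ha : a ∈ ({h, h⁻¹, p, p⁻¹} : Set SL(2, ℝ)))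
    (hb : b ∈ ({h, h⁻¹, p, p⁻¹} : Set SL(2, ℝ))) {u v : ℕ → ℍ} {γ γ' : SL(2, ℝ)}
    (hu : Tendsto (fun n => toSphere (u n)) atTop (𝓝 (bdry ξ)))
    (hv : Tendsto (fun n => toSphere (v n)) atTop (𝓝 (bdry ξ)))
    (hua : ∀ᶠ n in atTop, γ⁻¹ • u n ∈ halfPlane o a)
    (hvb : ∀ᶠ n in atTop, γ⁻¹ • v n ∈ halfPlane o b)
    (hγ : γ ∈ genGroup h p) (hγ' : γ' ∈ genGroup h p) :
    horoNorm ξ (γ • o) ≤ horoNorm ξ (γ' • o) := by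
  obtain ⟨l, hl, hprod⟩ := exists_reducedWord (mul_mem ((genGroup h p).inv_mem hγ) hγ')
  have key : ∀ (w : ℕ → ℍ), Tendsto (fun n => toSphere (w n)) atTop (𝓝 (bdry ξ)) →
      ∀ c ∈ ({h, h⁻¹, p, p⁻¹} : Set SL(2, ℝ)), (∀ᶠ n in atTop, γ⁻¹ • w n ∈ halfPlane o c) →
      (∀ d ∈ l.head?, c ≠ d) → horoNorm ξ (γ • o) ≤ horoNorm ξ (γ' • o) := by
    intro w hw c hc hwc hne
    refine horoNorm_le_of_tendsto hw ?_
    filter_upwards [hwc] with n hn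
    have := H.dist_le_dist_prod hl (z := γ⁻¹ • w n) fun d hd =>
      H.notMem hc (hl.1 d (List.mem_of_mem_head? hd)) (hne d hd) hn
    rwa [hprod, dist_inv_smul_left, dist_inv_smul_left, ← mul_smul, mul_inv_cancel_left] at this
  -- The first letter of the word for γ⁻¹γ' cannot equal both `a` and `b`; the sequence in the other
  -- half-plane is used.
  by_cases hc : ∀ d ∈ l.head?, a ≠ d
  · exact key u hu a ha hua hc
  · push Not at hc
    obtain ⟨d, hd, rfl⟩ := hc
    refine key v hv b hb hvb fun e he => ?_
    rw [Option.mem_def] at hd he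
    rw [hd, Option.some_inj] at he
    exact he ▸ hab.symm

end

/-! ### Schottky pairs, radial limit points and their codings. -/

section

variable {o : ℍ} {h p : SL(2, ℝ)} {ξ : OnePoint ℝ}

lemma IsSchottkyPair.four_lt (hhp : IsSchottkyPair o h p) : 4 < (h 0 0 + h 1 1) ^ 2 := by
  have := hhp.hyperbolic
  rw [Matrix.IsHyperbolic, Matrix.discr_fin_two, h.2, Matrix.trace_fin_two] at this
  linarith

lemma IsSchottkyPair.sq_eq_four (hhp : IsSchottkyPair o h p) : (p 0 0 + p 1 1) ^ 2 = 4 := by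
  have := hhp.parabolic.2
  rw [Matrix.discr_fin_two, p.2, Matrix.trace_fin_two] at this
  linarith

lemma disjoint_of_disjoint_closure {A B : Set ℍ}
    (hAB : Disjoint (closure (toSphere '' A)) (closure (toSphere '' B))) : Disjoint A B :=
  (Set.disjoint_image_iff toSphere_injective).1 (hAB.mono subset_closure subset_closure)

lemma IsSchottkyPair.isPingPong (hhp : IsSchottkyPair o h p) :
    IsPingPong o {h, h⁻¹, p, p⁻¹} := by
  have hh := disjoint_of_disjoint_closure (disjoint_closure_halfPlane_inv o hhp.four_lt)
  have hp := disjoint_halfPlane_inv_of_parabolic o hhp.parabolic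
  have hhp' := disjoint_of_disjoint_closure hhp.disjoint
  rw [Set.disjoint_union_left, Set.disjoint_union_right, Set.disjoint_union_right] at hhp'
  obtain ⟨⟨h1, h2⟩, h3, h4⟩ := hhp'
  have ne_of {a : SL(2, ℝ)} (ha : Disjoint (halfPlane o a) (halfPlane o a⁻¹)) : a ≠ a⁻¹ :=
    fun haa => Set.disjoint_left.1 ha (smul_base_mem_halfPlane o a)
      (haa ▸ smul_base_mem_halfPlane o a)
  refine ⟨Set.toFinite _, ?_, ?_, ?_⟩
  · rintro a (rfl | rfl | rfl | rfl) <;> simp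
  · rintro a (ha | ha | ha | ha) <;> rw [ha]
    · exact ne_of hh
    · rw [inv_inv]; exact (ne_of hh).symm
    · exact ne_of hp
    · rw [inv_inv]; exact (ne_of hp).symm
  · rintro a (ha | ha | ha | ha) b (hb | hb | hb | hb) hab <;> rw [ha, hb] at hab ⊢ <;>
    first
    | exact absurd rfl hab
    | assumption
    | (apply Disjoint.symm; assumption)

/-- Distinct half-planes, not both bounded by the bisectors for `p` and `p⁻¹`, are seen from `o`
at definite angle. -/
lemma IsSchottkyPair.exists_mul_cosh_le_sinh (hhp : IsSchottkyPair o h p) :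
    ∃ δ : ℝ, 0 < δ ∧ δ ≤ 1 ∧ ∀ a ∈ ({h, h⁻¹, p, p⁻¹} : Set SL(2, ℝ)),
      ∀ b ∈ ({h, h⁻¹, p, p⁻¹} : Set SL(2, ℝ)), a ≠ b →
      ¬ (a ∈ ({p, p⁻¹} : Set SL(2, ℝ)) ∧ b ∈ ({p, p⁻¹} : Set SL(2, ℝ))) →
      ∀ u ∈ halfPlane o a, ∀ v ∈ halfPlane o b,
      δ * Real.cosh (dist u o / 2) * Real.cosh (dist v o / 2) ≤ Real.sinh (dist u v / 2) := by
  obtain ⟨δ₁, h₁, H₁⟩ :=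
    CuspedPants.exists_mul_cosh_le_sinh o (disjoint_closure_halfPlane_inv o hhp.four_lt)
  obtain ⟨δ₂, h₂, H₂⟩ := CuspedPants.exists_mul_cosh_le_sinh o hhp.disjoint
  set δ := min 1 (min δ₁ δ₂) with hδ
  have key {A B : Set ℍ} {ε : ℝ} (hε : δ ≤ ε) (HAB : ∀ u ∈ A, ∀ v ∈ B,
      ε * Real.cosh (dist u o / 2) * Real.cosh (dist v o / 2) ≤ Real.sinh (dist u v / 2)) :
      (∀ u ∈ A, ∀ v ∈ B, δ * Real.cosh (dist u o / 2) * Real.cosh (dist v o / 2) ≤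
        Real.sinh (dist u v / 2)) ∧ ∀ u ∈ B, ∀ v ∈ A, δ * Real.cosh (dist u o / 2) *
        Real.cosh (dist v o / 2) ≤ Real.sinh (dist u v / 2) := by
    have hle : ∀ u ∈ A, ∀ v ∈ B, δ * Real.cosh (dist u o / 2) * Real.cosh (dist v o / 2) ≤
        Real.sinh (dist u v / 2) := fun u hu v hv => by
      refine le_trans ?_ (HAB u hu v hv)
      have := Real.cosh_pos (dist u o / 2)
      have := Real.cosh_pos (dist v o / 2)
      gcongr
    refine ⟨hle, fun u hu v hv => ?_⟩
    rw [mul_right_comm, dist_comm u v]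
    exact hle v hv u hu
  have hδ₁ : δ ≤ δ₁ := (min_le_right _ _).trans (min_le_left _ _)
  have hδ₂ : δ ≤ δ₂ := (min_le_right _ _).trans (min_le_right _ _)
  obtain ⟨k1, k2⟩ := key hδ₁ H₁
  obtain ⟨k3, k4⟩ := key hδ₂ H₂
  refine ⟨δ, by positivity, min_le_left _ _, ?_⟩
  rintro a ha b hb hab hnot u hu v hv
  have hcase : ∀ c ∈ ({h, h⁻¹, p, p⁻¹} : Set SL(2, ℝ)), (c = h ∨ c = h⁻¹) ∨
      c ∈ ({p, p⁻¹} : Set SL(2, ℝ)) := by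
    rintro c (hc | hc | hc | hc) <;> simp [hc]
  have hmh : ∀ c, (c = h ∨ c = h⁻¹) → halfPlane o c ⊆ halfPlane o h ∪ halfPlane o h⁻¹ := by
    rintro c (rfl | rfl)
    exacts [subset_union_left, subset_union_right]
  have hmp : ∀ c ∈ ({p, p⁻¹} : Set SL(2, ℝ)),
      halfPlane o c ⊆ halfPlane o p ∪ halfPlane o p⁻¹ := by
    rintro c (rfl | rfl)
    exacts [subset_union_left, subset_union_right]
  rcases hcase a ha with ha' | ha' <;> rcases hcase b hb with hb' | hb'
  · rcases ha' with rfl | ha' <;> rcases hb' with rfl | hb'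
    · exact absurd rfl hab
    · exact k1 u hu v (hb' ▸ hv)
    · exact k2 u (ha' ▸ hu) v hv
    · exact absurd (ha'.trans hb'.symm) hab
  · exact k3 u (hmh a ha' hu) v (hmp b hb' hv)
  · exact k4 u (hmp a ha' hu) v (hmh b hb' hv)
  · exact absurd ⟨ha', hb'⟩ hnot

lemma exists_ray_of_mem_radialLimitSet {Γ : Subgroup SL(2, ℝ)} (hξ : ξ ∈ radialLimitSet Γ) :
    ∃ σ, IsGeodesicRayTo σ ξ := by
  obtain ⟨-, -, -, σ, -, hσ, -⟩ := hξ
  exact ⟨σ, hσ⟩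

/-- Radial limit points are horospherical. -/
lemma exists_tendsto_horoNorm_of_mem_radialLimitSet {Γ : Subgroup SL(2, ℝ)} (o : ℍ)
    (hξ : ξ ∈ radialLimitSet Γ) : ∃ γ : ℕ → SL(2, ℝ), (∀ n, γ n ∈ Γ) ∧
      Tendsto (fun n => horoNorm ξ (γ n • o)) atTop (𝓝 0) ∧
      Tendsto (fun n => toSphere (γ n • o)) atTop (𝓝 (bdry ξ)) := by
  obtain ⟨-, z, γ, σ, c, hσ, hγ, hc⟩ := hξ
  have hdz : Tendsto (fun n => dist (σ 0) (γ n • z)) atTop atTop := tendsto_dist_atTop hγ _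
  have ht : ∀ n, ∃ t : ℝ≥0, dist (γ n • z) (σ t) < c + 1 := fun n => by
    have h1 : Metric.infDist (γ n • z) (range σ) < c + 1 := (hc n).trans_lt (lt_add_one c)
    obtain ⟨_, ⟨t, rfl⟩, hy⟩ := (Metric.infDist_lt_iff (range_nonempty σ)).1 h1
    exact ⟨t, hy⟩
  choose t ht using ht
  have htt : Tendsto (fun n => (t n : ℝ)) atTop atTop := by
    refine tendsto_atTop_mono (fun n => ?_) (tendsto_atTop_add_const_right _ (-(c + 1)) hdz)
    have h1 := dist_triangle (σ 0) (σ (t n)) (γ n • z)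
    rw [hσ.dist_eq, dist_comm (σ (t n))] at h1
    simp only [NNReal.coe_zero, zero_sub, abs_neg, NNReal.abs_eq] at h1
    linarith [ht n]
  have hK : Tendsto (fun n => horoNorm ξ ((γ n : SL(2, ℝ)) • o)) atTop (𝓝 0) := by
    have h0 : Tendsto (fun n => Real.exp (dist o z / 2) * (Real.exp ((c + 1) / 2) *
        (Real.exp (-((t n : ℝ) / 2)) * horoNorm ξ (σ 0)))) atTop
        (𝓝 (Real.exp (dist o z / 2) * (Real.exp ((c + 1) / 2) * (0 * horoNorm ξ (σ 0))))) := by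
      refine Tendsto.const_mul _ (Tendsto.const_mul _ (Tendsto.mul_const _ ?_))
      exact Real.tendsto_exp_atBot.comp
        (tendsto_neg_atTop_atBot.comp (htt.atTop_div_const two_pos))
    simp only [zero_mul, mul_zero] at h0
    refine squeeze_zero (fun n => (horoNorm_pos _ _).le) (fun n => ?_) h0
    have h1 := horoNorm_le_exp_mul ξ ((γ n : SL(2, ℝ)) • o) ((γ n : SL(2, ℝ)) • z)
    have h2 := horoNorm_le_exp_mul ξ ((γ n : SL(2, ℝ)) • z) (σ (t n))
    rw [dist_smul] at h1
    rw [hσ.horoNorm_eq] at h2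
    have h3 : Real.exp (dist ((γ n : SL(2, ℝ)) • z) (σ (t n)) / 2) ≤ Real.exp ((c + 1) / 2) :=
      Real.exp_le_exp.2 (div_le_div_of_nonneg_right (ht n).le two_pos.le)
    have h4 := horoNorm_pos ξ (σ 0)
    refine h1.trans (mul_le_mul_of_nonneg_left (h2.trans ?_) (Real.exp_pos _).le)
    gcongr
  refine ⟨fun n => γ n, fun n => (γ n).2, hK, ?_⟩
  refine tendsto_of_horoNorm_le (o := σ 0) (c := 1) ?_ ?_
  · exact (hK.eventually_lt_const one_pos).mono fun n hn => hn.le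
  · refine tendsto_atTop_mono (fun n => ?_) (tendsto_atTop_add_const_right _ (-(dist z o)) hdz)
    have h1 := dist_triangle (σ 0) ((γ n : SL(2, ℝ)) • o) ((γ n : SL(2, ℝ)) • z)
    rw [dist_smul, dist_comm o z] at h1
    change dist (σ 0) ((γ n : SL(2, ℝ)) • z) + _ ≤ _
    linarith

/-- Used twice: against two codings of one point, and against codings ending in a constant parabolic
tail. -/
lemma not_forall_horoNorm_le_of_mem_radialLimitSet {Γ : Subgroup SL(2, ℝ)}
    (hξ : ξ ∈ radialLimitSet Γ) (γ : SL(2, ℝ)) :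
    ¬ ∀ γ' ∈ Γ, horoNorm ξ (γ • o) ≤ horoNorm ξ (γ' • o) := by
  intro hall
  obtain ⟨g, hg, hK, -⟩ := exists_tendsto_horoNorm_of_mem_radialLimitSet o hξ
  exact absurd (ge_of_tendsto hK (Eventually.of_forall fun n => hall _ (hg n)))
    (not_le.2 (horoNorm_pos _ _))

lemma dist_prod_smul_le {o : ℍ} {L : ℝ} {l : List SL(2, ℝ)} (hl : ∀ a ∈ l, dist o (a • o) ≤ L) :
    dist o (l.prod • o) ≤ l.length * L := by
  induction l with
  | nil => simp
  | cons a l ih =>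
    have h1 := ih fun b hb => hl b (List.mem_cons_of_mem _ hb)
    have h2 := hl a (by simp)
    have h3 := dist_triangle o (a • o) (a • l.prod • o)
    rw [dist_smul] at h3
    rw [List.prod_cons, mul_smul, List.length_cons]
    push_cast
    linarith

lemma IsPingPong.exists_dist_le {S : Set SL(2, ℝ)} (H : IsPingPong o S) :
    ∃ L : ℝ, 0 ≤ L ∧ ∀ a ∈ S, dist o (a • o) ≤ L := by
  obtain ⟨L, hL⟩ := (H.finite.image fun a => dist o (a • o)).bddAbove
  exact ⟨max L 0, le_max_right _ _, fun a ha =>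
    (hL (mem_image_of_mem _ ha)).trans (le_max_left _ _)⟩

/-- Every limit point is the limit of the partial products of an infinite reduced sequence. -/
lemma IsPingPong.exists_isCoding (H : IsPingPong o {h, h⁻¹, p, p⁻¹}) {γ : ℕ → SL(2, ℝ)}
    (hγ : ∀ n, γ n ∈ genGroup h p)
    (hlim : Tendsto (fun n => toSphere (γ n • o)) atTop (𝓝 (bdry ξ))) :
    ∃ s, IsCoding o h p s ξ := by
  choose l hl hprod using fun n => exists_reducedWord (hγ n)
  obtain ⟨L, hL0, hL⟩ := H.exists_dist_le
  have hlen : ∀ m : ℕ, ∀ᶠ n in atTop, m < (l n).length := by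
    intro m
    filter_upwards [(tendsto_dist_atTop hlim o).eventually_gt_atTop (m * L)] with n hn
    by_contra! hle
    have h1 := dist_prod_smul_le fun a ha => hL a ((hl n).1 a ha)
    rw [hprod] at h1
    have : ((l n).length : ℝ) * L ≤ m * L := by gcongr
    linarith
  -- The alphabet is finite and the word lengths tend to infinity, so along an ultrafilter every
  -- position has a limiting letter.
  set U : Ultrafilter ℕ := Ultrafilter.of atTop
  have hU : (U : Filter ℕ) ≤ atTop := Ultrafilter.of_le atTop
  have hex : ∀ i : ℕ, ∃ a ∈ ({h, h⁻¹, p, p⁻¹} : Set SL(2, ℝ)), ∀ᶠ n in U, (l n)[i]? = some a := by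
    intro i
    refine (Ultrafilter.finite_biUnion_mem_iff H.finite).1 ?_
    filter_upwards [hU (hlen i)] with n hn
    exact mem_biUnion ((hl n).1 _ (List.getElem_mem hn)) (List.getElem?_eq_getElem hn)
  choose s hsS hs using hex
  have hred : IsReducedSeqIn {h, h⁻¹, p, p⁻¹} s := by
    refine ⟨hsS, fun i => ?_⟩
    obtain ⟨n, h1, h2⟩ := ((hs i).and (hs (i + 1))).exists
    obtain ⟨hi, h1⟩ := List.getElem?_eq_some_iff.1 h1
    obtain ⟨hi', h2⟩ := List.getElem?_eq_some_iff.1 h2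
    rw [← h1, ← h2]
    exact List.isChain_iff_getElem.1 (hl n).2 i hi'
  have htake : ∀ m, ∀ᶠ n in U, (l n).take m = (List.range m).map s := by
    intro m
    induction m with
    | zero => simp
    | succ m ih =>
      filter_upwards [ih, hs m] with n h1 h2
      rw [List.take_add_one, h1, h2, List.range_succ]
      simp
  have hmem : ∀ m, ∀ᶠ n in U, (partialProd s m)⁻¹ • γ n • o ∈ halfPlane o (s m) := by
    intro m
    filter_upwards [htake m, hs m] with n h1 h2
    obtain ⟨hm, h2⟩ := List.getElem?_eq_some_iff.1 h2
    have h3 : γ n = partialProd s m * ((l n).drop m).prod := by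
      rw [partialProd_eq_prod, ← h1, ← hprod n, ← List.prod_append, List.take_append_drop]
    have h4 := (hl n).drop m
    rw [h3, mul_smul, inv_smul_smul]
    rw [List.drop_eq_getElem_cons hm, h2] at h4 ⊢
    exact H.prod_smul_mem h4
  -- Each new letter brings the partial product no farther from the points `γ n • o` along `U`, so
  -- all partial products stay in the horoball at `ξ` through `o`.
  have hK : ∀ m, horoNorm ξ (partialProd s m • o) ≤ horoNorm ξ o := by
    intro m
    induction m with
    | zero => simp [partialProd]
    | succ m ih =>
      refine le_trans ?_ ih
      refine horoNorm_le_of_tendsto (hlim.mono_left hU) ?_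
      filter_upwards [hmem m] with n hn
      simp only [halfPlane, mem_ofPred_eq] at hn
      rwa [dist_inv_smul_left, dist_inv_smul_left, ← mul_smul] at hn
  exact ⟨s, hred, tendsto_of_horoNorm_le (Eventually.of_forall hK)
    (H.tendsto_dist_partialProd hred)⟩

lemma letters_subset_genGroup (h p : SL(2, ℝ)) :
    ({h, h⁻¹, p, p⁻¹} : Set SL(2, ℝ)) ⊆ genGroup h p := by
  have hh : h ∈ genGroup h p := Subgroup.subset_closure (by simp)
  have hp : p ∈ genGroup h p := Subgroup.subset_closure (by simp)
  rintro a (rfl | rfl | rfl | rfl)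
  exacts [hh, inv_mem hh, hp, inv_mem hp]

/-- At the first disagreement both codings sit at one orbit point and continue into different
half-planes, making that point minimal for `horoNorm ξ`. -/
lemma IsPingPong.eq_of_isCoding (H : IsPingPong o {h, h⁻¹, p, p⁻¹})
    (hξ : ξ ∈ radialLimitSet (genGroup h p)) {s t : ℕ → SL(2, ℝ)} (hs : IsCoding o h p s ξ)
    (ht : IsCoding o h p t ξ) : s = t := by
  by_contra hne
  have hex : ∃ k, s k ≠ t k := Function.ne_iff.1 hne
  classical
  set k := Nat.find hex
  have hk : s k ≠ t k := Nat.find_spec hex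
  have heq : partialProd s k = partialProd t k := partialProd_congr fun i hi => by
    simpa using Nat.find_min hex hi
  have hmem := partialProd_mem hs.1 (letters_subset_genGroup h p) k
  refine not_forall_horoNorm_le_of_mem_radialLimitSet hξ (partialProd s k) fun γ' hγ' =>
    H.horoNorm_le hk (hs.1.1 k) (ht.1.1 k) hs.2 ht.2 ?_ ?_ hmem hγ'
  · filter_upwards [eventually_gt_atTop k] with n hn
    exact H.inv_partialProd_smul_mem hs.1 hn
  · filter_upwards [eventually_gt_atTop k] with n hn
    rw [heq]
    exact H.inv_partialProd_smul_mem ht.1 hn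

lemma IsSchottkyPair.existsUnique_isCoding (hhp : IsSchottkyPair o h p)
    (hξ : ξ ∈ radialLimitSet (genGroup h p)) : ∃! s, IsCoding o h p s ξ := by
  obtain ⟨γ, hγ, -, hlim⟩ := exists_tendsto_horoNorm_of_mem_radialLimitSet o hξ
  obtain ⟨s, hs⟩ := hhp.isPingPong.exists_isCoding hγ hlim
  exact ⟨s, hs, fun t ht => hhp.isPingPong.eq_of_isCoding hξ ht hs⟩

end

/-! ### Cusp excursions and the size of exponents. -/

section

variable {o : ℍ} {h p : SL(2, ℝ)} {ξ : OnePoint ℝ} {s : ℕ → SL(2, ℝ)}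

/-- The position `m` is not interior to a block of letters `p` or `p⁻¹` of `s`. -/
def IsTransition (p : SL(2, ℝ)) (s : ℕ → SL(2, ℝ)) (m : ℕ) : Prop :=
  ∀ k, m = k + 1 → ¬ (s k ∈ ({p, p⁻¹} : Set SL(2, ℝ)) ∧ s (k + 1) ∈ ({p, p⁻¹} : Set SL(2, ℝ)))

lemma inv_mem_pair {p a : SL(2, ℝ)} (ha : a⁻¹ ∈ ({p, p⁻¹} : Set SL(2, ℝ))) :
    a ∈ ({p, p⁻¹} : Set SL(2, ℝ)) := by
  rcases ha with ha | ha
  · exact Or.inr (by rw [mem_singleton_iff, ← ha, inv_inv])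
  · exact Or.inl (inv_injective ha)

/-- The points of the coded orbit at transitions lie near every ray to the coded point. -/
lemma IsSchottkyPair.exists_dist_ray_le (hhp : IsSchottkyPair o h p) (hs : IsCoding o h p s ξ)
    {σ : ℝ≥0 → ℍ} (hσ : IsGeodesicRayTo σ ξ) :
    ∃ C : ℝ, 0 ≤ C ∧ ∀ m, IsTransition p s m → ∃ t, dist (partialProd s m • o) (σ t) ≤ C := by
  obtain ⟨δ, hδ, hδ1, hsep⟩ := hhp.exists_mul_cosh_le_sinh
  obtain ⟨C, hC, hnear⟩ := hσ.exists_dist_le o hδ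
  have H := hhp.isPingPong
  refine ⟨C, hC, fun m hm => hnear _ ?_⟩
  -- Position 0 is vacuously a transition; there the point is `o` and `δ ≤ 1` suffices.
  cases m with
  | zero =>
    simp only [partialProd, one_smul, dist_self, zero_div, Real.cosh_zero, mul_one]
    exact mul_le_of_le_one_left (horoNorm_pos _ _).le hδ1
  | succ k =>
    rw [← le_div_iff₀ (horoNorm_pos _ _)]
    refine ge_of_tendsto (tendsto_cosh_div_cosh hs.2 o (partialProd s (k + 1) • o)) ?_
    filter_upwards [eventually_gt_atTop (k + 1)] with n hn
    -- Seen from the current orbit point, `o` lies behind in D((s k)⁻¹) and the later points ahead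
    -- in D(s (k + 1)); the transition hypothesis separates the two.
    have h1 := H.inv_partialProd_base_mem hs.1 k
    have h2 := H.inv_partialProd_smul_mem hs.1 hn
    have h3 := hsep _ (H.inv_mem _ (hs.1.1 k)) _ (hs.1.1 (k + 1)) (hs.1.2 k).symm
      (fun hP => hm k rfl ⟨inv_mem_pair hP.1, hP.2⟩) _ h1 _ h2
    rw [dist_smul, dist_inv_smul_left, dist_inv_smul_left, dist_comm o (partialProd s n • o)] at h3
    rw [le_div_iff₀ (Real.cosh_pos _)]
    exact h3.trans (Real.sinh_lt_cosh _).le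

lemma trace_sq_conj {g : SL(2, ℝ)} (hg : (g 0 0 + g 1 1) ^ 2 = 4) (x : SL(2, ℝ)) :
    ((x * g * x⁻¹) 0 0 + (x * g * x⁻¹) 1 1) ^ 2 = 4 := by
  have h1 : ((x * g * x⁻¹ : SL(2, ℝ)) : Matrix (Fin 2) (Fin 2) ℝ).trace =
      (g : Matrix (Fin 2) (Fin 2) ℝ).trace := by
    rw [Matrix.SpecialLinearGroup.coe_mul, Matrix.trace_mul_comm,
      ← Matrix.SpecialLinearGroup.coe_mul, inv_mul_cancel_left]
  rw [Matrix.trace_fin_two, Matrix.trace_fin_two] at h1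
  rw [h1, hg]

lemma sq_trace_inv {g : SL(2, ℝ)} : g⁻¹ 0 0 + g⁻¹ 1 1 = g 0 0 + g 1 1 := by
  simp [Matrix.SpecialLinearGroup.SL2_inv_expl, add_comm]

lemma exists_horoNorm_pow_smul_eq {g : SL(2, ℝ)} (hg : (g 0 0 + g 1 1) ^ 2 = 4)
    (x : SL(2, ℝ)) : ∃ ξ : OnePoint ℝ, ∀ (z : ℍ) (n : ℕ),
      horoNorm ξ ((x * g ^ n) • z) = horoNorm ξ (x • z) ∧
      horoNorm ξ ((x * g⁻¹ ^ n) • z) = horoNorm ξ (x • z) := by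
  obtain ⟨ξ, hξ⟩ := exists_horoNorm_smul_eq (trace_sq_conj hg x)
  have h1 : ∀ z, horoNorm ξ ((x * g) • z) = horoNorm ξ (x • z) := fun z => by
    rw [← hξ (x • z), ← mul_smul, inv_mul_cancel_right]
  refine ⟨ξ, fun z n => ⟨?_, ?_⟩⟩
  · induction n generalizing z with
    | zero => simp
    | succ n ih => rw [pow_succ, ← mul_assoc, mul_smul, ih, ← mul_smul, h1]
  · induction n generalizing z with
    | zero => simp
    | succ n ih =>
      rw [pow_succ, ← mul_assoc, mul_smul, ih, ← h1, ← mul_smul, mul_assoc, mul_inv_cancel,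
        mul_one]

lemma IsPingPong.isReducedSeqIn_const {S : Set SL(2, ℝ)} (H : IsPingPong o S) {g : SL(2, ℝ)}
    (hg : g ∈ S) : IsReducedSeqIn S (fun _ => g) :=
  ⟨fun _ => hg, fun _ => H.ne_inv g hg⟩

lemma IsPingPong.tendsto_dist_pow {S : Set SL(2, ℝ)} (H : IsPingPong o S) {g : SL(2, ℝ)}
    (hg : g ∈ S) : Tendsto (fun n : ℕ => dist o (g ^ n • o)) atTop atTop := by
  simpa only [partialProd_const] using H.tendsto_dist_partialProd (H.isReducedSeqIn_const hg)

/-- A parabolic fixed point lies outside all horoballs through the other points of the orbit. -/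
lemma IsPingPong.exists_parabolic_point (H : IsPingPong o {h, h⁻¹, p, p⁻¹}) {g : SL(2, ℝ)}
    (hgS : g ∈ ({h, h⁻¹, p, p⁻¹} : Set SL(2, ℝ))) (hg : (g 0 0 + g 1 1) ^ 2 = 4)
    {x : SL(2, ℝ)} (hx : x ∈ genGroup h p) : ∃ η : OnePoint ℝ,
      (∀ n : ℕ, horoNorm η ((x * g ^ n) • o) = horoNorm η (x • o)) ∧
      Tendsto (fun n : ℕ => toSphere ((x * g ^ n) • o)) atTop (𝓝 (bdry η)) ∧
      ∀ γ ∈ genGroup h p, horoNorm η (x • o) ≤ horoNorm η (γ • o) := by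
  obtain ⟨η, hη⟩ := exists_horoNorm_pow_smul_eq hg x
  have hdist : ∀ a ∈ ({h, h⁻¹, p, p⁻¹} : Set SL(2, ℝ)),
      Tendsto (fun n : ℕ => dist o ((x * a ^ n) • o)) atTop atTop := fun a ha => by
    refine tendsto_atTop_mono (fun n => ?_)
      (tendsto_atTop_add_const_right _ (-dist o (x • o)) (H.tendsto_dist_pow ha))
    have h1 := dist_triangle (x • o) o ((x * a ^ n) • o)
    rw [mul_smul, dist_smul, dist_comm (x • o)] at h1
    rw [mul_smul]
    linarith
  have hmem : ∀ a ∈ ({h, h⁻¹, p, p⁻¹} : Set SL(2, ℝ)),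
      ∀ᶠ n : ℕ in atTop, x⁻¹ • (x * a ^ n) • o ∈ halfPlane o a := fun a ha => by
    filter_upwards [eventually_ge_atTop 1] with n hn
    obtain ⟨m, rfl⟩ := Nat.exists_eq_add_of_le' hn
    rw [mul_smul, inv_smul_smul, ← partialProd_const]
    exact H.partialProd_smul_mem (H.isReducedSeqIn_const ha) m
  have hinv := H.inv_mem g hgS
  -- Positive and negative powers stay on one horosphere and leave every ball, so `η` is approached
  -- through two different half-planes.
  have h1 : Tendsto (fun n : ℕ => toSphere ((x * g ^ n) • o)) atTop (𝓝 (bdry η)) :=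
    tendsto_of_horoNorm_le (Eventually.of_forall fun n => (hη o n).1.le) (hdist g hgS)
  have h2 : Tendsto (fun n : ℕ => toSphere ((x * g⁻¹ ^ n) • o)) atTop (𝓝 (bdry η)) :=
    tendsto_of_horoNorm_le (Eventually.of_forall fun n => (hη o n).2.le) (hdist g⁻¹ hinv)
  exact ⟨η, fun n => (hη o n).1, h1, fun γ hγ =>
    H.horoNorm_le (H.ne_inv g hgS) hgS hinv h1 h2 (hmem g hgS) (hmem g⁻¹ hinv) hx hγ⟩

lemma pair_subset_letters (h p : SL(2, ℝ)) :
    ({p, p⁻¹} : Set SL(2, ℝ)) ⊆ {h, h⁻¹, p, p⁻¹} := by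
  rintro g (rfl | rfl) <;> simp

lemma IsSchottkyPair.sq_eq_four_of_mem (hhp : IsSchottkyPair o h p) {g : SL(2, ℝ)}
    (hg : g ∈ ({p, p⁻¹} : Set SL(2, ℝ))) : (g 0 0 + g 1 1) ^ 2 = 4 := by
  rcases hg with rfl | hg
  · exact hhp.sq_eq_four
  · rw [mem_singleton_iff.1 hg, sq_trace_inv, hhp.sq_eq_four]

/-- The coding of a radial limit point is not eventually constant equal to `p` or `p⁻¹`. -/
lemma IsSchottkyPair.exists_ne_of_mem_radialLimitSet (hhp : IsSchottkyPair o h p)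
    (hξ : ξ ∈ radialLimitSet (genGroup h p)) (hs : IsCoding o h p s ξ) {g : SL(2, ℝ)}
    (hg : g ∈ ({p, p⁻¹} : Set SL(2, ℝ))) (i : ℕ) : ∃ j, s (i + j) ≠ g := by
  by_contra! hall
  have H := hhp.isPingPong
  obtain ⟨η, -, hlim, hle⟩ := H.exists_parabolic_point (pair_subset_letters h p hg)
    (hhp.sq_eq_four_of_mem hg) (partialProd_mem hs.1 (letters_subset_genGroup h p) i)
  have h1 : ∀ n, partialProd s (n + i) = partialProd s i * g ^ n := fun n => by
    rw [add_comm, partialProd_add, ← partialProd_const,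
      partialProd_congr (t := fun _ => g) fun j _ => hall j]
  have h2 : Tendsto (fun n => toSphere ((partialProd s i * g ^ n) • o)) atTop (𝓝 (bdry ξ)) := by
    simpa only [Function.comp_def, h1] using hs.2.comp (tendsto_add_atTop_nat i)
  obtain rfl := bdry_injective (tendsto_nhds_unique h2 hlim)
  exact not_forall_horoNorm_le_of_mem_radialLimitSet hξ _ hle

lemma exists_isMaximalBlock {g : SL(2, ℝ)} {k n : ℕ} (hn : 1 ≤ n) (hk : ∀ j < n, s (k + j) = g)
    (hne : ∃ j, s (k + j) ≠ g) : ∃ i m, n ≤ m ∧ IsMaximalBlock s g i m := by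
  classical
  have hstart : ∃ i, i ≤ k ∧ ∀ j, i ≤ j → j ≤ k → s j = g :=
    ⟨k, le_rfl, fun j h1 h2 => by
      obtain rfl : j = k := le_antisymm h2 h1
      exact hk 0 hn⟩
  obtain ⟨hik, hi⟩ := Nat.find_spec hstart
  have hmin := fun m => Nat.find_min hstart (m := m)
  generalize Nat.find hstart = i at hik hi hmin
  have he := Nat.find_spec hne
  have hmin' := fun m => Nat.find_min hne (m := m)
  generalize Nat.find hne = e at he hmin'
  have hne' : n ≤ e := by
    by_contra! hlt
    exact he (hk e hlt)
  refine ⟨i, k - i + e, by omega, by omega, fun j hj => ?_, ?_, fun j hj hsj => ?_⟩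
  · rcases le_or_gt (i + j) k with hle | hlt
    · exact hi _ (by omega) hle
    · have := hmin' (i + j - k) (by omega)
      rwa [not_not, show k + (i + j - k) = i + j by omega] at this
  · rwa [show i + (k - i + e) = k + e by omega]
  · refine hmin j (by omega) ⟨by omega, fun l h1 h2 => ?_⟩
    rcases h1.eq_or_lt with rfl | h1
    · exact hsj
    · exact hi l (by omega) h2

lemma eq_or_eq_inv_of_mem_pair {g a : SL(2, ℝ)} (hg : g ∈ ({p, p⁻¹} : Set SL(2, ℝ)))
    (ha : a ∈ ({p, p⁻¹} : Set SL(2, ℝ))) : a = g ∨ a = g⁻¹ := by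
  rcases hg with hg | hg <;> rcases ha with ha | ha <;>
    simp_all

/-- Otherwise N + 2 consecutive non-transitions lie in one run of equal parabolic letters, as p and
p⁻¹ cannot be adjacent. The run is finite because `ξ` is radial, so it gives an exponent exceeding
`N`. -/
lemma IsSchottkyPair.exists_isTransition (hhp : IsSchottkyPair o h p)
    (hξ : ξ ∈ radialLimitSet (genGroup h p)) (hs : IsCoding o h p s ξ) {N : ℕ}
    (hN : ∀ n ∈ exponents p s, |n| ≤ (N : ℤ)) (k : ℕ) :
    ∃ j ≤ N + 1, IsTransition p s (k + j) := by
  by_contra! hcon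
  have hP : ∀ j ≤ N + 1, s (k + j) ∈ ({p, p⁻¹} : Set SL(2, ℝ)) ∧
      ∀ i, k + j = i + 1 → s i ∈ ({p, p⁻¹} : Set SL(2, ℝ)) := fun j hj => by
    have := hcon j hj
    simp only [IsTransition, not_forall, not_not] at this
    obtain ⟨i, hi, h1, h2⟩ := this
    refine ⟨hi ▸ h2, fun i' hi' => ?_⟩
    obtain rfl : i = i' := by omega
    exact h1
  have hconst : ∀ j ≤ N + 1, s (k + j) = s k := by
    intro j
    induction j with
    | zero => simp
    | succ j ih =>
      intro hj
      have h1 := ih (by omega)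
      rcases eq_or_eq_inv_of_mem_pair (hP j (by omega)).1 (hP (j + 1) hj).1 with h2 | h2
      · exact h2.trans h1
      · exact absurd h2 (hs.1.2 (k + j))
  have hk : s k ∈ ({p, p⁻¹} : Set SL(2, ℝ)) := (hP 0 (by omega)).1
  obtain ⟨i, m, hm, hblock⟩ := exists_isMaximalBlock (n := N + 1) (by omega)
    (fun j hj => hconst j (by omega)) (hhp.exists_ne_of_mem_radialLimitSet hξ hs hk k)
  rcases hk with hk | hk <;> rw [hk] at hblock
  · have := hN m ⟨i, m, Or.inl ⟨hblock, rfl⟩⟩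
    rw [Nat.abs_cast] at this
    omega
  · have := hN (-m) ⟨i, m, Or.inr ⟨hblock, rfl⟩⟩
    rw [abs_neg, Nat.abs_cast] at this
    omega

lemma dist_partialProd_add_le {S : Set SL(2, ℝ)} (hs : IsReducedSeqIn S s) {L : ℝ}
    (hL : ∀ a ∈ S, dist o (a • o) ≤ L) (k j : ℕ) :
    dist (partialProd s k • o) (partialProd s (k + j) • o) ≤ j * L := by
  rw [partialProd_add, mul_smul, dist_smul, partialProd_eq_prod]
  have hl := (hs.shift k).isReducedWord j
  simpa using dist_prod_smul_le fun a ha => hL a (hl.1 a ha)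

/-- Every partial product is within `C'` of the ray, at a parameter `t k`. These parameters tend to
infinity in bounded steps, so they are coarsely dense in the ray. -/
lemma IsSchottkyPair.mem_boundedRadialLimitSet (hhp : IsSchottkyPair o h p)
    (hξ : ξ ∈ radialLimitSet (genGroup h p)) (hs : IsCoding o h p s ξ) {N : ℕ}
    (hN : ∀ n ∈ exponents p s, |n| ≤ (N : ℤ)) :
    ξ ∈ boundedRadialLimitSet (genGroup h p) o := by
  obtain ⟨σ, hσ⟩ := exists_ray_of_mem_radialLimitSet hξ
  obtain ⟨C, hC, hnear⟩ := hhp.exists_dist_ray_le hs hσ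
  obtain ⟨L, hL0, hL⟩ := hhp.isPingPong.exists_dist_le
  set C' := C + (N + 1) * L with hC'
  have hC'0 : 0 ≤ C' := by positivity
  have ht : ∀ k, ∃ t, dist (partialProd s k • o) (σ t) ≤ C' := fun k => by
    obtain ⟨j, hj, htr⟩ := hhp.exists_isTransition hξ hs hN k
    obtain ⟨t, ht⟩ := hnear _ htr
    refine ⟨t, (dist_triangle _ (partialProd s (k + j) • o) _).trans ?_⟩
    have h1 := dist_partialProd_add_le hs.1 hL k j
    have h2 : (j : ℝ) * L ≤ (N + 1) * L := by
      have : (j : ℝ) ≤ N + 1 := by exact_mod_cast hj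
      gcongr
    linarith
  choose t ht using ht
  have hstep : ∀ k, |(t k : ℝ) - t (k + 1)| ≤ 2 * C' + L := fun k => by
    rw [← hσ.dist_eq]
    have h1 := dist_triangle4 (σ (t k)) (partialProd s k • o) (partialProd s (k + 1) • o)
      (σ (t (k + 1)))
    have h2 := dist_partialProd_add_le hs.1 hL k 1
    have h3 := ht k
    rw [dist_comm] at h3
    have h4 := ht (k + 1)
    simp only [Nat.cast_one, one_mul] at h2
    linarith
  have htop : Tendsto (fun k => (t k : ℝ)) atTop atTop := by
    refine tendsto_atTop_mono (fun k => ?_)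
      (tendsto_atTop_add_const_right _ (-C') (tendsto_dist_atTop hs.2 (σ 0)))
    have h1 := dist_triangle (σ 0) (σ (t k)) (partialProd s k • o)
    rw [hσ.dist_eq, dist_comm (σ (t k))] at h1
    simp only [NNReal.coe_zero, zero_sub, abs_neg, NNReal.abs_eq] at h1
    linarith [ht k]
  -- `t 0` covers the segment before the first parameter, `2 * C' + L` one step, another `C'` the
  -- passage to the orbit, and 1 the strict inequality.
  refine ⟨hξ.1, σ, t 0 + 3 * C' + L + 1, hσ, fun u => ?_⟩
  have hex : ∃ k, (u : ℝ) ≤ t k := (htop.eventually_ge_atTop (u : ℝ)).exists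
  have hbound : ∃ k, |(u : ℝ) - t k| ≤ t 0 + 2 * C' + L := by
    classical
    have hspec := Nat.find_spec hex
    have hmin := fun m => Nat.find_min hex (m := m)
    generalize Nat.find hex = k at hspec hmin
    refine ⟨k, ?_⟩
    rw [abs_sub_comm, abs_of_nonneg (by linarith)]
    have hu : (0 : ℝ) ≤ u := u.2
    have ht0 : (0 : ℝ) ≤ t 0 := (t 0).2
    cases k with
    | zero => linarith
    | succ k =>
      have h1 := hmin k (Nat.lt_succ_self k)
      have h2 := hstep k
      rw [abs_sub_comm] at h2
      linarith [le_abs_self ((t (k + 1) : ℝ) - t k)]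
  obtain ⟨k, hk⟩ := hbound
  have hmem : partialProd s k • o ∈ MulAction.orbit (genGroup h p) o :=
    ⟨⟨_, partialProd_mem hs.1 (letters_subset_genGroup h p) k⟩, rfl⟩
  have h1 := Metric.infDist_le_dist_of_mem (x := σ u) hmem
  have h2 := dist_triangle (σ u) (σ (t k)) (partialProd s k • o)
  have h3 := ht k
  rw [hσ.dist_eq] at h2
  rw [dist_comm] at h3
  linarith

/-- A neighbour of the block is not `g` by maximality and not `g⁻¹` by reducedness; likewise at the
other end. -/
lemma IsMaximalBlock.isTransition_start (hs : IsReducedSeq h p s) {g : SL(2, ℝ)}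
    (hg : g ∈ ({p, p⁻¹} : Set SL(2, ℝ))) {i k : ℕ} (hb : IsMaximalBlock s g i k) :
    IsTransition p s i := by
  rintro j rfl ⟨hj, -⟩
  have h0 : s (j + 1) = g := hb.2.1 0 hb.1
  rcases eq_or_eq_inv_of_mem_pair hg hj with h1 | h1
  · exact hb.2.2.2 j rfl h1
  · exact hs.2 j (by rw [h0, h1, inv_inv])

lemma IsMaximalBlock.isTransition_stop (hs : IsReducedSeq h p s) {g : SL(2, ℝ)}
    (hg : g ∈ ({p, p⁻¹} : Set SL(2, ℝ))) {i k : ℕ} (hb : IsMaximalBlock s g i k) :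
    IsTransition p s (i + k) := by
  rintro j hj ⟨-, hj'⟩
  have hk := hb.1
  have h0 : s j = g := by
    have := hb.2.1 (k - 1) (by omega)
    rwa [show i + (k - 1) = j by omega] at this
  rcases eq_or_eq_inv_of_mem_pair hg hj' with h1 | h1
  · exact hb.2.2.1 (hj ▸ h1)
  · exact hs.2 j (by rw [h0, h1])

/-- The midpoint of a geodesic segment whose endpoints are close to a horosphere lies deep inside
the horoball. -/
lemma cosh_mul_horoNorm_le {η : OnePoint ℝ} {u v w : ℍ} {T B : ℝ} (hT : 0 < T)
    (huv : dist u v = T) (huw : dist u w = T / 2) (hwv : dist w v = T / 2)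
    (hu : horoNorm η u ≤ B) (hv : horoNorm η v ≤ B) :
    Real.cosh (T / 4) * horoNorm η w ≤ B := by
  have h1 := sinh_half_dist_mul_horoNorm_le η u w v
  have hsinh : 0 < Real.sinh (T / 4) := Real.sinh_pos_iff.2 (by linarith)
  -- Ptolemy reads sinh(T/2) K(w) ≤ sinh(T/4) (K(u) + K(v)); doubling the angle on the left lets 2
  -- sinh(T/4) cancel.
  rw [huv, huw, hwv, show T / 2 / 2 = T / 4 by ring, show T / 2 = 2 * (T / 4) by ring,
    Real.sinh_two_mul] at h1
  have h2 : Real.sinh (T / 4) * horoNorm η v ≤ Real.sinh (T / 4) * B := by gcongr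
  have h3 : Real.sinh (T / 4) * horoNorm η u ≤ Real.sinh (T / 4) * B := by gcongr
  refine le_of_mul_le_mul_left ?_ (mul_pos two_pos hsinh)
  linarith

lemma IsSchottkyPair.notMem_boundedRadialLimitSet (hhp : IsSchottkyPair o h p)
    (hs : IsCoding o h p s ξ) (hunb : HasUnboundedExponents p s) :
    ξ ∉ boundedRadialLimitSet (genGroup h p) o := by
  rintro ⟨-, σ, c, hσ, hc⟩
  have H := hhp.isPingPong
  obtain ⟨C, hC, hnear⟩ := hhp.exists_dist_ray_le hs hσ
  set M := Real.exp ((c + C) / 2) with hM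
  have hM0 : 0 < M := Real.exp_pos _
  -- Replacing the block's ends by points of the ray costs `2 * C`. The remaining `8 * M`
  -- contradicts the final bound cosh(d/4) ≤ M, since cosh(d/4) ≥ d/8.
  obtain ⟨K, hK⟩ := eventually_atTop.1
    (((H.tendsto_dist_pow (g := p) (by simp)).eventually_gt_atTop (2 * C + 8 * M)).and
      ((H.tendsto_dist_pow (g := p⁻¹) (by simp)).eventually_gt_atTop (2 * C + 8 * M)))
  obtain ⟨g, hg, i, k, hKk, hb⟩ : ∃ g ∈ ({p, p⁻¹} : Set SL(2, ℝ)), ∃ i k, K < k ∧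
      IsMaximalBlock s g i k := by
    obtain ⟨n, ⟨i, k, ⟨hb, rfl⟩ | ⟨hb, rfl⟩⟩, hn⟩ := hunb K
    · exact ⟨p, by simp, i, k, by rw [Nat.abs_cast] at hn; exact_mod_cast hn, hb⟩
    · exact ⟨p⁻¹, by simp, i, k, by rw [abs_neg, Nat.abs_cast] at hn; exact_mod_cast hn, hb⟩
  have hdist : 2 * C + 8 * M < dist o (g ^ k • o) := by
    rcases hg with hg | hg <;> rw [hg]
    exacts [(hK k hKk.le).1, (hK k hKk.le).2]
  set x := partialProd s i with hx
  have hxΓ : x ∈ genGroup h p := partialProd_mem hs.1 (letters_subset_genGroup h p) i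
  have hxk : partialProd s (i + k) = x * g ^ k := by
    rw [partialProd_add, ← partialProd_const, partialProd_congr (t := fun _ => g) hb.2.1]
  obtain ⟨t₁, ht₁⟩ := hnear i (hb.isTransition_start hs.1 hg)
  obtain ⟨t₂, ht₂⟩ := hnear (i + k) (hb.isTransition_stop hs.1 hg)
  rw [hxk] at ht₂
  obtain ⟨η, hpow, -, hmin⟩ := H.exists_parabolic_point (pair_subset_letters h p hg)
    (hhp.sq_eq_four_of_mem hg) (one_mem (genGroup h p))
  simp only [one_mul, one_smul] at hpow hmin
  have hT : 8 * M < dist (σ t₁) (σ t₂) := by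
    have h1 := dist_triangle4 (x • o) (σ t₁) (σ t₂) ((x * g ^ k) • o)
    rw [mul_smul, dist_smul] at h1
    rw [mul_smul, dist_comm] at ht₂
    linarith
  have hu : horoNorm η (x⁻¹ • σ t₁) ≤ Real.exp (C / 2) * horoNorm η o := by
    refine (horoNorm_le_exp_mul η _ o).trans ?_
    rw [dist_inv_smul_left, dist_comm]
    have := horoNorm_pos η o
    gcongr
  have hv : horoNorm η (x⁻¹ • σ t₂) ≤ Real.exp (C / 2) * horoNorm η o := by
    refine (horoNorm_le_exp_mul η _ (g ^ k • o)).trans ?_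
    rw [hpow, dist_inv_smul_left, ← mul_smul, dist_comm]
    have := horoNorm_pos η o
    gcongr
  set t : ℝ≥0 := (t₁ + t₂) / 2 with ht
  have htc : (t : ℝ) = (t₁ + t₂) / 2 := by rw [ht]; push_cast; rfl
  have hmid := cosh_mul_horoNorm_le (η := η) (w := x⁻¹ • σ t) (by linarith) (dist_smul _ _ _)
    (by
      rw [dist_smul, hσ.dist_eq, hσ.dist_eq, htc, ← abs_two, ← abs_div, abs_two]
      congr 1
      ring)
    (by
      rw [dist_smul, hσ.dist_eq, hσ.dist_eq, htc, ← abs_two, ← abs_div, abs_two]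
      congr 1
      ring) hu hv
  obtain ⟨_, ⟨⟨γ, hγ⟩, rfl⟩, hγt⟩ :=
    (Metric.infDist_lt_iff (MulAction.nonempty_orbit (M := genGroup h p) o)).1 (hc t)
  change dist (σ t) (γ • o) < c at hγt
  -- No orbit point is inside the horoball at `η` through `o`, so a point within `c` of the orbit
  -- has limited depth in it.
  have hlow : horoNorm η o ≤ Real.exp (c / 2) * horoNorm η (x⁻¹ • σ t) := by
    refine (hmin (x⁻¹ * γ) (mul_mem (inv_mem hxΓ) hγ)).trans
      ((horoNorm_le_exp_mul η _ (x⁻¹ • σ t)).trans ?_)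
    rw [mul_smul, dist_smul, dist_comm]
    have := horoNorm_pos η (x⁻¹ • σ t)
    gcongr
  have hcosh : Real.cosh (dist (σ t₁) (σ t₂) / 4) ≤ M := by
    refine le_of_mul_le_mul_right ?_ (horoNorm_pos η o)
    calc Real.cosh (dist (σ t₁) (σ t₂) / 4) * horoNorm η o
        ≤ Real.cosh (dist (σ t₁) (σ t₂) / 4) *
          (Real.exp (c / 2) * horoNorm η (x⁻¹ • σ t)) :=
          mul_le_mul_of_nonneg_left hlow (Real.cosh_pos _).le
      _ = Real.exp (c / 2) * (Real.cosh (dist (σ t₁) (σ t₂) / 4) *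
          horoNorm η (x⁻¹ • σ t)) := by ring
      _ ≤ Real.exp (c / 2) * (Real.exp (C / 2) * horoNorm η o) :=
          mul_le_mul_of_nonneg_left hmid (Real.exp_pos _).le
      _ = M * horoNorm η o := by rw [← mul_assoc, ← Real.exp_add, hM]; ring_nf
  have := half_le_cosh (dist (σ t₁) (σ t₂) / 4)
  linarith

end

end CuspedPants

theorem mainTheorem3 (o : UpperHalfPlane) (h p : Matrix.SpecialLinearGroup (Fin 2) ℝ)
    (hhp : CuspedPants.IsSchottkyPair o h p)
    (ξ : OnePoint ℝ) (hξ : ξ ∈ CuspedPants.limitSet (CuspedPants.genGroup h p)) :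
    (ξ ∈ CuspedPants.radialLimitSet (CuspedPants.genGroup h p) →
      ∃! s : ℕ → Matrix.SpecialLinearGroup (Fin 2) ℝ, CuspedPants.IsCoding o h p s ξ) ∧
    (ξ ∈ CuspedPants.unboundedRadialLimitSet (CuspedPants.genGroup h p) o ↔
      ξ ∈ CuspedPants.radialLimitSet (CuspedPants.genGroup h p) ∧
        ∃ s : ℕ → Matrix.SpecialLinearGroup (Fin 2) ℝ,
          CuspedPants.IsCoding o h p s ξ ∧ CuspedPants.HasUnboundedExponents p s) := by
  refine ⟨hhp.existsUnique_isCoding, ?_, ?_⟩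
  · rintro ⟨hr, hb⟩
    obtain ⟨s, hs, -⟩ := hhp.existsUnique_isCoding hr
    refine ⟨hr, s, hs, fun N => ?_⟩
    by_contra! hN
    exact hb (hhp.mem_boundedRadialLimitSet hr hs (N := N.toNat) fun n hn =>
      (hN n hn).trans (Int.self_le_toNat N))
  · rintro ⟨hr, s, hs, hunb⟩
    exact ⟨hr, hhp.notMem_boundedRadialLimitSet hs hunb⟩
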